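/- Let $\{X_t\}_{t\in\mathbb Z}$ be a strictly stationary Gaussian time series with values in $\mathbb R^m$, with autocovariances $\gamma_{jk}(h)=\operatorname{Cov}(X_{t+h,j},X_{t,k})$. Assume that its spectral density matrix $f(w)=\frac1{2\pi}\sum_{h\in\mathbb Z}e^{-iwh}\gamma(h)$ is well defined (the series converge absolutely) and that every entry $f_{jk}$ is four times continuously differentiable on $\mathbb R$. Let $\theta\in\{0,\pi,-\pi\}$, and let $K$ be a kernel on $[0,1]$: nonnegative, Riemann integrable, with $\int_0^1K>0$. **Estimator.** Given $X_1,\dots,X_n$ with sample mean $\bar X$, let $\hat\gamma_{jk}(h)=\frac1n\sum_{t:\,1\le t,\,t+h\le n}(X_{t+h,j}-\bar X_j)(X_{t,k}-\bar X_k)$ (the sum is over $t$ with both $t$ and $t+h$ in $\{1,\dots,n\}$), let $I_{jk}(w)=\frac1{2\pi}\sum_{|h|<n}e^{-iwh}\hat\gamma_{jk}(h)$ be the periodogram, and let $w_s=2\pi s/n$. For a bandwidth fraction $\delta$ let $M=\lfloor\delta n\rfloor$. The estimator $\tilde f_{jk}(\theta)$ is the intercept in the weighted least squares regression of $\operatorname{Re}I_{jk}(w_s)$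 on a constant and $(\theta-w_s)^2$, with weights $K_\delta(|\theta-w_s|)$, $K_\delta(x)=(2\pi\delta)^{-1}K(x/(2\pi\delta))$, over $s=1,\dots,M$ if $\theta=0$ and over $s=\lfloor n/2\rfloor-M+1,\dots,\lfloor n/2\rfloor$ if $\theta=\pi$; the estimator for $\theta=-\pi$ is the one for $\theta=\pi$. (Ordinary least squares is the case $K\equiv1$.) Write $\tilde f(\theta)=(\tilde f_{jk}(\theta))_{j,k}$ and $\mathrm{MSE}[\tilde f_{jk}(\theta)]=E|\tilde f_{jk}(\theta)-f_{jk}(\theta)|^2$. **Claim.** 1. For all $j,k$ the mean squared error is finite and $$\mathrm{MSE}[\tilde f_{jk}(\theta)]=O(\delta^8)+O(\delta^{-1}n^{-1}),$$ that is, there are constants $C,L$, not depending on $n$ and $\delta$, such that $\mathrm{MSE}[\tilde f_{jk}(\theta)]\le C\delta^8+C\delta^{-1}n^{-1}$ whenever $0<\delta<1/2$ and $\delta n\ge L$. 2. The order of magnitude of this rate is minimized when $\delta=\delta_n\sim Cn^{-1/9}$ for a constant $C>0$: for every such $\delta_n$ we have $\delta_n^8+\delta_n^{-1}n^{-1}\asymp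 n^{-8/9}$, and $\delta_n^8+\delta_n^{-1}n^{-1}=O(\eta_n^8+\eta_n^{-1}n^{-1})$ for every sequence $\eta_n$ that is positive for all large $n$. In particular $\mathrm{MSE}[\tilde f_{jk}(\theta)]=O(n^{-8/9})$ for all $j,k$. 3. With any such choice $\delta=\delta_n\sim Cn^{-1/9}$, $C>0$, the matrix estimator satisfies $$\tilde f(\theta)=f(\theta)+O_P(n^{-4/9}).$$ -/

import Mathlib

open MeasureTheory ProbabilityTheory Filter Topology Asymptotics
open scoped Matrix

attribute [local instance] Matrix.normedAddCommGroup

noncomputable section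

namespace LocalQuad

/-! ### The process and its spectral density -/

section TimeSeries

variable {Ω : Type*} [MeasurableSpace Ω] {m : ℕ}

/-- Strict stationarity: the law of the whole path on `ℤ` is invariant under time shifts. -/
def StrictlyStationary (P : Measure Ω) (X : ℤ → Ω → (Fin m → ℝ)) : Prop :=
  ∀ h : ℤ, P.map (fun ω (t : ℤ) => X (t + h) ω) = P.map (fun ω (t : ℤ) => X t ω)

/-- The autocovariance `γ_{jk}(h) = Cov(X_{t+h,j}, X_{t,k})`, evaluated at `t = 0`
(it does not depend on `t` for a stationary process). -/
def autocov (P : Measure Ω) (X : ℤ → Ω → (Fin m → ℝ)) (j k : Fin m) (h : ℤ) : ℝ :=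
  covariance (fun ω => X h ω j) (fun ω => X 0 ω k) P

/-- The spectral density matrix `f(w) = (2π)⁻¹ ∑_{h ∈ ℤ} e^{-iwh} γ(h)`. -/
def specDensity (P : Measure Ω) (X : ℤ → Ω → (Fin m → ℝ)) (w : ℝ) :
    Matrix (Fin m) (Fin m) ℂ :=
  fun j k => (2 * (Real.pi : ℂ))⁻¹ *
    ∑' h : ℤ, Complex.exp (-(Complex.I * w * h)) * (autocov P X j k h : ℂ)

/-- Assumption A(p): the spectral density matrix is well defined (its series converge) and all its
entries are `p` times continuously differentiable functions of the real variable `w`. -/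
def AssumptionA (P : Measure Ω) (X : ℤ → Ω → (Fin m → ℝ)) (p : ℕ) : Prop :=
  ∀ j k : Fin m, Summable (autocov P X j k) ∧ ContDiff ℝ p (fun w : ℝ => specDensity P X w j k)

end TimeSeries

/-! ### The estimator, as a function of a path `x` (only `x 1, …, x n` are used) -/

section Estimator

variable {m : ℕ}

/-- The sample mean `n⁻¹ ∑_{t=1}^n x_t`. -/
def sampleMean (n : ℕ) (x : ℤ → (Fin m → ℝ)) (j : Fin m) : ℝ :=
  (n : ℝ)⁻¹ * ∑ t ∈ Finset.Icc (1 : ℤ) n, x t j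

/-- The sample autocovariance
`γ̂_{jk}(h) = n⁻¹ ∑_t (x_{t+h,j} - x̄_j) (x_{t,k} - x̄_k)`, the sum being over all `t` such that both
`t` and `t + h` lie in `{1, …, n}`. It vanishes for `|h| ≥ n`, and `γ̂(-h)` is the transpose
of `γ̂(h)`. -/
def sampleAutocov (n : ℕ) (x : ℤ → (Fin m → ℝ)) (j k : Fin m) (h : ℤ) : ℝ :=
  (n : ℝ)⁻¹ * ∑ t ∈ (Finset.Icc (1 : ℤ) n).filter (fun t => t + h ∈ Finset.Icc (1 : ℤ) n),
    (x (t + h) j - sampleMean n x j) * (x t k - sampleMean n x k)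

/-- The periodogram matrix `I(w) = (2π)⁻¹ ∑_{|h| < n} e^{-iwh} γ̂(h)`. -/
def periodogram (n : ℕ) (x : ℤ → (Fin m → ℝ)) (w : ℝ) : Matrix (Fin m) (Fin m) ℂ :=
  fun j k => (2 * (Real.pi : ℂ))⁻¹ *
    ∑ h ∈ Finset.Ioo (-(n : ℤ)) n,
      Complex.exp (-(Complex.I * w * h)) * (sampleAutocov n x j k h : ℂ)

/-- The number `M = [δ n]` of Fourier frequencies used in the regression. -/
def numFreq (n : ℕ) (δ : ℝ) : ℕ := ⌊δ * n⌋₊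

/-- The Fourier frequencies `w_s = 2πs/n` used in the regression:
`s = 1, …, M` for `θ = 0`, and `s = [n/2] - M + 1, …, [n/2]` for `θ = ± π`. -/
def regFreq (θ : ℝ) (n : ℕ) (δ : ℝ) (i : Fin (numFreq n δ)) : ℝ :=
  2 * Real.pi *
    (((if θ = 0 then (i : ℤ) + 1 else ((n / 2 : ℕ) : ℤ) - numFreq n δ + 1 + i) : ℤ) : ℝ) / n

/-- The distance `| θ - w_s |` of the `i`th frequency from `θ`; for `θ = -π` the estimator is the
same as for `θ = π`, whence the `|θ|`. -/
def regDist (θ : ℝ) (n : ℕ) (δ : ℝ) (i : Fin (numFreq n δ)) : ℝ :=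
  |(|θ| - regFreq θ n δ i)|

/-- The design matrix: a column of ones and a column of values `(θ - w_s)²`. -/
def designMatrix (θ : ℝ) (n : ℕ) (δ : ℝ) : Matrix (Fin (numFreq n δ)) (Fin 2) ℝ :=
  Matrix.of fun i => ![1, regDist θ n δ i ^ 2]

/-- The diagonal matrix of weights `K_δ(|θ - w_s|)`, where
`K_δ(x) = (2πδ)⁻¹ K(x / (2πδ))`. -/
def weightMatrix (K : ℝ → ℝ) (θ : ℝ) (n : ℕ) (δ : ℝ) :
    Matrix (Fin (numFreq n δ)) (Fin (numFreq n δ)) ℝ :=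
  Matrix.diagonal fun i =>
    (2 * Real.pi * δ)⁻¹ * K (regDist θ n δ i / (2 * Real.pi * δ))

/-- The response vector: real parts of the `(j, k)` periodogram ordinates. -/
def response (θ : ℝ) (n : ℕ) (δ : ℝ) (x : ℤ → (Fin m → ℝ)) (j k : Fin m) :
    Fin (numFreq n δ) → ℝ :=
  fun i => (periodogram n x (regFreq θ n δ i) j k).re

/-- The local quadratic estimator `f̃(θ)`: its `(j, k)` entry is the intercept of the weighted least
squares regression, i.e. the first entry of `(XᵀWX)⁻¹ XᵀWY`. Ordinary least squares
is the case `K = 1`. -/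
def localQuad (K : ℝ → ℝ) (θ : ℝ) (n : ℕ) (δ : ℝ) (x : ℤ → (Fin m → ℝ)) :
    Matrix (Fin m) (Fin m) ℝ :=
  fun j k =>
    (((designMatrix θ n δ)ᵀ * weightMatrix K θ n δ * designMatrix θ n δ)⁻¹ *ᵥ
      ((designMatrix θ n δ)ᵀ *ᵥ (weightMatrix K θ n δ *ᵥ response θ n δ x j k))) 0

end Estimator

/-- A kernel on `[0, 1]`: nonnegative, Riemann integrable (bounded and almost everywhere
continuous), with positive integral. -/
structure IsKernel (K : ℝ → ℝ) : Prop where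
  nonneg : ∀ x ∈ Set.Icc (0 : ℝ) 1, 0 ≤ K x
  bounded : ∃ B : ℝ, ∀ x ∈ Set.Icc (0 : ℝ) 1, K x ≤ B
  ae_continuousAt : ∀ᵐ x ∂(volume.restrict (Set.Icc (0 : ℝ) 1)), ContinuousAt K x
  integral_pos : 0 < ∫ x in (0 : ℝ)..1, K x

section Error

variable {Ω : Type*} [MeasurableSpace Ω] {m : ℕ}

/-- The estimation error `f̃(θ) - f(θ)`, a random complex matrix. -/
def estError (P : Measure Ω) (X : ℤ → Ω → (Fin m → ℝ)) (K : ℝ → ℝ) (θ : ℝ) (n : ℕ) (δ : ℝ)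
    (ω : Ω) : Matrix (Fin m) (Fin m) ℂ :=
  (localQuad K θ n δ (fun t => X t ω)).map Complex.ofReal - specDensity P X θ

/-- The mean squared error `E |f̃_{jk}(θ) - f_{jk}(θ)|²`. -/
def mse (P : Measure Ω) (X : ℤ → Ω → (Fin m → ℝ)) (K : ℝ → ℝ) (θ : ℝ) (n : ℕ) (δ : ℝ)
    (j k : Fin m) : ℝ :=
  ∫ ω, ‖estError P X K θ n δ ω j k‖ ^ 2 ∂P

/-- `Y_n = O_P(a_n)`: for every `ε > 0` there is `B` such that `P(‖Y_n‖ > B a_n) ≤ ε` for all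
large `n`. -/
def IsBigOInProb {E : Type*} [Norm E] (P : Measure Ω) (Y : ℕ → Ω → E) (a : ℕ → ℝ) : Prop :=
  ∀ ε : ℝ, 0 < ε → ∃ B : ℝ, ∀ᶠ n in atTop,
    P {ω | B * a n < ‖Y n ω‖} ≤ ENNReal.ofReal ε

end Error

/-- The rate `δ⁸ + δ⁻¹ n⁻¹`. -/
def mseRate (n : ℕ) (δ : ℝ) : ℝ := δ ^ 8 + δ⁻¹ * (n : ℝ)⁻¹

end LocalQuad

end

namespace LocalQuad

/-! ### Moments of Gaussian variables -/

/-! The intercept is a fixed linear combination of periodogram ordinates. Once `δ * n` is large, its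
coefficients sum to one, annihilate the squared distances and are `O(1 / (δ n))`
(`IsKernel.exists_wlsCoeff_bound`); the size bound rests on a lower bound of order `(δ n) ^ 2` for
the Gram determinant. All frequencies used are nonzero Fourier frequencies, where centering is
invisible, so the estimator is a quadratic form in the series centered at its true mean
(`localQuad_eq_quadratic`).

Bias (`abs_bias_le`): the expected ordinate is a Cesàro mean of the Fourier series of `f`. It misses
the real part of `f` by `O(1 / n)`, because smoothness makes `|h| |γ(h)|` summable. Reflection in
`0` or `± π` conjugates `f`, so its real part is even there and equals `f(θ) + A d ^ 2 + O(d ^ 4)`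
at distance `d`. The coefficients kill the quadratic term, which leaves a bias `O(δ ^ 4 + 1 / n)`.

Variance: by Isserlis' formula it is a sum over two pairings of covariances. Schur's test with
summable autocovariances bounds it by a constant times the squared Frobenius norm of the form
(`sum_sum_cov_le`). Orthogonality of the cosines bounds that norm by the sum of squared regression
coefficients, which is `O(1 / (δ n))` (`sum_sq_quadratic_coeff_le`).

The rate is optimal at `n ^ (-1/9)` since on either side of this value one of its two terms is
already at least `n ^ (-8/9)`. Markov's inequality for each entry then gives the statement in
probability. -/

lemma integral_sq_gaussianReal (v : NNReal) : ∫ x, x ^ 2 ∂(gaussianReal 0 v) = v := by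
  have h := variance_id_gaussianReal (μ := 0) (v := v)
  rw [variance_eq_integral measurable_id.aemeasurable] at h
  simpa [integral_id_gaussianReal] using h

/-- Fourth derivative at zero of the moment generating function `exp (v t ^ 2 / 2)`. -/
lemma integral_pow_four_gaussianReal (v : NNReal) :
    ∫ x, x ^ 4 ∂(gaussianReal 0 v) = 3 * (v : ℝ) ^ 2 := by
  have h0 : (0 : ℝ) ∈ interior (integrableExpSet id (gaussianReal 0 v)) := by
    simp [integrableExpSet_id_gaussianReal]
  have h := iteratedDeriv_mgf_zero h0 4
  have hint : ∫ x, x ^ 4 ∂(gaussianReal 0 v) = ∫ x, (id ^ 4 : ℝ → ℝ) x ∂(gaussianReal 0 v) := rfl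
  rw [hint, ← h, mgf_id_gaussianReal]
  -- Each derivative keeps the form polynomial times exponential and replaces `p` by `p' + v t p`;
  -- iterating from `p = 1` leaves the value `3 v ^ 2` at zero.
  have step : ∀ p p' : ℝ → ℝ, (∀ t, HasDerivAt p (p' t) t) →
      deriv (fun t : ℝ => p t * Real.exp (0 * t + v * t ^ 2 / 2)) =
        fun t => (p' t + p t * (v * t)) * Real.exp (0 * t + v * t ^ 2 / 2) := by
    intro p p' hp
    funext t
    have he : HasDerivAt (fun t : ℝ => Real.exp (0 * t + v * t ^ 2 / 2))
        (Real.exp (0 * t + v * t ^ 2 / 2) * (v * t)) t := by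
      have h1 : HasDerivAt (fun t : ℝ => 0 * t + v * t ^ 2 / 2) (v * t) t := by
        have := ((hasDerivAt_id t).const_mul (0 : ℝ)).add
          ((((hasDerivAt_id t).pow 2).const_mul (v : ℝ)).div_const 2)
        refine this.congr_deriv ?_
        simp
        ring
      exact h1.exp
    have h2 : HasDerivAt (fun t : ℝ => p t * Real.exp (0 * t + v * t ^ 2 / 2)) _ t := (hp t).mul he
    rw [h2.deriv]
    ring
  have d0 : (fun t : ℝ => Real.exp (0 * t + v * t ^ 2 / 2)) =
      fun t => (1 : ℝ) * Real.exp (0 * t + v * t ^ 2 / 2) := by simp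
  rw [d0]
  simp only [iteratedDeriv_succ, iteratedDeriv_zero]
  rw [step (fun _ => 1) (fun _ => 0) (fun t => hasDerivAt_const t 1),
    step (fun t => 0 + 1 * (v * t)) (fun _ => v) (fun t => by
      simpa using (hasDerivAt_id t).const_mul (v : ℝ)),
    step (fun t => v + (0 + 1 * (v * t)) * (v * t)) (fun t => 2 * v ^ 2 * t) (fun t => by
      have := (((hasDerivAt_id t).pow 2).const_mul ((v : ℝ) ^ 2)).const_add (v : ℝ)
      refine (this.congr_deriv ?_).congr_of_eventuallyEq (Eventually.of_forall fun x => ?_)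
      · simp; ring
      · simp; ring),
    step (fun t => 2 * v ^ 2 * t + (v + (0 + 1 * (v * t)) * (v * t)) * (v * t))
      (fun t => 3 * v ^ 2 + 3 * v ^ 3 * t ^ 2) (fun t => by
      have := ((hasDerivAt_id t).const_mul (3 * (v : ℝ) ^ 2)).add
        (((hasDerivAt_id t).pow 3).const_mul ((v : ℝ) ^ 3))
      refine (this.congr_deriv ?_).congr_of_eventuallyEq (Eventually.of_forall fun x => ?_)
      · simp; ring
      · simp; ring)]
  simp

/-! ### Isserlis' formula and quadratic forms in Gaussian processes. -/

section GaussianProcess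

variable {Ω ι κ : Type*} [MeasurableSpace Ω] {P : Measure Ω} {W : ι → Ω → ℝ}

lemma integral_centered_pow_four {Z : Ω → ℝ} (hZ : HasGaussianLaw Z P) :
    ∫ ω, (Z ω - ∫ ω', Z ω' ∂P) ^ 4 ∂P = 3 * (∫ ω, (Z ω - ∫ ω', Z ω' ∂P) ^ 2 ∂P) ^ 2 := by
  have hm : AEMeasurable Z P := hZ.aemeasurable
  set v := Var[Z; P].toNNReal
  have hl : HasLaw Z (gaussianReal (∫ ω, Z ω ∂P) v) P := ⟨hm, hZ.map_eq_gaussianReal⟩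
  have hl' := gaussianReal_sub_const hl (∫ ω, Z ω ∂P)
  rw [sub_self] at hl'
  have h4 : ∫ ω, (Z ω - ∫ ω', Z ω' ∂P) ^ 4 ∂P = ∫ x, x ^ 4 ∂(gaussianReal 0 v) := by
    rw [← hl'.map_eq, integral_map hl'.aemeasurable (by fun_prop)]
  have h2 : ∫ ω, (Z ω - ∫ ω', Z ω' ∂P) ^ 2 ∂P = ∫ x, x ^ 2 ∂(gaussianReal 0 v) := by
    rw [← hl'.map_eq, integral_map hl'.aemeasurable (by fun_prop)]
  rw [h4, h2, integral_sq_gaussianReal, integral_pow_four_gaussianReal]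

/-- Lets Hölder's inequality place a product of two `L⁴` variables in `L²`. -/
instance holderTriple_four_four_two : ENNReal.HolderTriple 4 4 2 where
  inv_add_inv_eq_inv := by
    have h4 : (4 : ENNReal) = 2 * 2 := by norm_num
    rw [h4, ENNReal.mul_inv (by simp) (by simp), ← mul_add, ENNReal.inv_two_add_inv_two, mul_one]

lemma memLp_centered (hW : IsGaussianProcess W P) (i : ι) {p : ENNReal} (hp : p ≠ ⊤) :
    MemLp (fun ω => W i ω - ∫ ω', W i ω' ∂P) p P := by
  have := hW.isProbabilityMeasure
  exact ((hW.hasGaussianLaw_eval i).memLp hp).sub (memLp_const _)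

lemma memLp_centered_mul (hW : IsGaussianProcess W P) (i k : ι) :
    MemLp (fun ω => (W i ω - ∫ ω', W i ω' ∂P) * (W k ω - ∫ ω', W k ω' ∂P)) 2 P :=
  (memLp_centered hW k (p := 4) (by simp)).mul (memLp_centered hW i (p := 4) (by simp))

/-- Isserlis' formula for the fourth order moments of a Gaussian process. -/
lemma isserlis (hW : IsGaussianProcess W P) (a b c d : ι) :
    ∫ ω, ((W a ω - ∫ ω', W a ω' ∂P) * (W b ω - ∫ ω', W b ω' ∂P)) *
        ((W c ω - ∫ ω', W c ω' ∂P) * (W d ω - ∫ ω', W d ω' ∂P)) ∂P =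
      cov[W a, W b; P] * cov[W c, W d; P] + cov[W a, W c; P] * cov[W b, W d; P] +
        cov[W a, W d; P] * cov[W b, W c; P] := by
  have := hW.isProbabilityMeasure
  set U : ι → Ω → ℝ := fun i ω => W i ω - ∫ ω', W i ω' ∂P with hU
  have hI2 : ∀ i k, Integrable (fun ω => U i ω * U k ω) P := fun i k =>
    (memLp_centered_mul hW i k).integrable (by norm_num)
  have hI1 : ∀ i, Integrable (W i) P := fun i =>
    ((hW.hasGaussianLaw_eval i).memLp (p := 1) (by simp)).integrable le_rfl
  have hcov : ∀ i k, cov[W i, W k; P] = ∫ ω, U i ω * U k ω ∂P := fun i k => rfl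
  -- Every linear combination is Gaussian, so its fourth central moment is determined by its
  -- variance.
  have hZ : ∀ x y z : ℝ, ∫ ω, (U a ω + x * U b ω + y * U c ω + z * U d ω) ^ 4 ∂P =
      3 * (∫ ω, (U a ω + x * U b ω + y * U c ω + z * U d ω) ^ 2 ∂P) ^ 2 := by
    intro x y z
    have hg := ((hW.comp_right ![a, b, c, d]).smul ![1, x, y, z]).hasGaussianLaw_fun_sum
      (I := Finset.univ)
    have h := integral_centered_pow_four hg
    have hm : ∫ ω, (W a ω + x * W b ω + y * W c ω + z * W d ω) ∂P =
        ∫ ω, W a ω ∂P + x * ∫ ω, W b ω ∂P + y * ∫ ω, W c ω ∂P + z * ∫ ω, W d ω ∂P := by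
      rw [integral_add, integral_add, integral_add, integral_const_mul, integral_const_mul,
        integral_const_mul]
      · exact hI1 a
      · exact (hI1 b).const_mul x
      · exact (hI1 a).add ((hI1 b).const_mul x)
      · exact (hI1 c).const_mul y
      · exact ((hI1 a).add ((hI1 b).const_mul x)).add ((hI1 c).const_mul y)
      · exact (hI1 d).const_mul z
    simp only [Fin.sum_univ_four, Function.comp, Matrix.cons_val, smul_eq_mul, one_mul, hm] at h
    have e : ∀ ω, U a ω + x * U b ω + y * U c ω + z * U d ω =
        W a ω + x * W b ω + y * W c ω + z * W d ω - (∫ ω, W a ω ∂P + x * ∫ ω, W b ω ∂P +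
          y * ∫ ω, W c ω ∂P + z * ∫ ω, W d ω ∂P) := fun ω => by simp only [hU]; ring
    simpa only [e] using h
  have h2 : ∀ x y z : ℝ, ∫ ω, (U a ω + x * U b ω + y * U c ω + z * U d ω) ^ 2 ∂P =
      cov[W a, W a; P] + x ^ 2 * cov[W b, W b; P] + y ^ 2 * cov[W c, W c; P] +
        z ^ 2 * cov[W d, W d; P] + (2 * x) * cov[W a, W b; P] + (2 * y) * cov[W a, W c; P] +
        (2 * z) * cov[W a, W d; P] + (2 * x * y) * cov[W b, W c; P] +
        (2 * x * z) * cov[W b, W d; P] + (2 * y * z) * cov[W c, W d; P] := by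
    intro x y z
    simp only [hcov, ← integral_const_mul]
    rw [← integral_add, ← integral_add, ← integral_add, ← integral_add, ← integral_add,
      ← integral_add, ← integral_add, ← integral_add, ← integral_add]
    · congr 1; ext ω; ring
    all_goals
      repeat' first | exact (hI2 _ _).const_mul _ | exact hI2 _ _ | apply Integrable.add
  have h4i : ∀ x y z : ℝ,
      Integrable (fun ω => (U a ω + x * U b ω + y * U c ω + z * U d ω) ^ 4) P := by
    intro x y z
    have hL : MemLp (fun ω => U a ω + x * U b ω + y * U c ω + z * U d ω) 4 P :=
      (((memLp_centered hW a (by simp)).add ((memLp_centered hW b (by simp)).const_mul x)).add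
        ((memLp_centered hW c (by simp)).const_mul y)).add
        ((memLp_centered hW d (by simp)).const_mul z)
    have hL2 : MemLp (fun ω => (U a ω + x * U b ω + y * U c ω + z * U d ω) *
      (U a ω + x * U b ω + y * U c ω + z * U d ω)) 2 P := hL.mul hL
    refine (hL2.integrable_mul hL2).congr (Eventually.of_forall fun ω => ?_)
    simp only [Pi.mul_apply]
    ring
  -- Polarization: weighting the eight sign choices by the product of their signs cancels every
  -- monomial except the mixed one, whose coefficient is `8 * 24 = 192`.
  have key : 192 * ∫ ω, (U a ω * U b ω) * (U c ω * U d ω) ∂P =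
      ∫ ω, (U a ω + 1 * U b ω + 1 * U c ω + 1 * U d ω) ^ 4 ∂P
      - ∫ ω, (U a ω + 1 * U b ω + 1 * U c ω + (-1) * U d ω) ^ 4 ∂P
      - ∫ ω, (U a ω + 1 * U b ω + (-1) * U c ω + 1 * U d ω) ^ 4 ∂P
      + ∫ ω, (U a ω + 1 * U b ω + (-1) * U c ω + (-1) * U d ω) ^ 4 ∂P
      - ∫ ω, (U a ω + (-1) * U b ω + 1 * U c ω + 1 * U d ω) ^ 4 ∂P
      + ∫ ω, (U a ω + (-1) * U b ω + 1 * U c ω + (-1) * U d ω) ^ 4 ∂P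
      + ∫ ω, (U a ω + (-1) * U b ω + (-1) * U c ω + 1 * U d ω) ^ 4 ∂P
      - ∫ ω, (U a ω + (-1) * U b ω + (-1) * U c ω + (-1) * U d ω) ^ 4 ∂P := by
    rw [← integral_const_mul, ← integral_sub, ← integral_sub, ← integral_add, ← integral_sub,
      ← integral_add, ← integral_add, ← integral_sub]
    · congr 1; ext ω; ring
    all_goals
      repeat' first | exact h4i _ _ _ | exact (h4i _ _ _).neg | apply Integrable.sub | apply Integrable.add
  simp only [hZ, h2] at key
  change ∫ ω, (U a ω * U b ω) * (U c ω * U d ω) ∂P = _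
  linear_combination key / 192

/-- Second moment of a quadratic form in a Gaussian process. -/
lemma integral_quadratic_sq (hW : IsGaussianProcess W P) (S : Finset κ) (A : κ → ℝ)
    (f g : κ → ι) :
    ∫ ω, (∑ i ∈ S, A i * ((W (f i) ω - ∫ ω', W (f i) ω' ∂P) *
        (W (g i) ω - ∫ ω', W (g i) ω' ∂P))) ^ 2 ∂P =
      (∑ i ∈ S, A i * cov[W (f i), W (g i); P]) ^ 2 +
      ∑ i ∈ S, ∑ k ∈ S, A i * A k * (cov[W (f i), W (f k); P] * cov[W (g i), W (g k); P] +
        cov[W (f i), W (g k); P] * cov[W (g i), W (f k); P]) := by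
  simp only [sq, Finset.sum_mul_sum, ← Finset.sum_add_distrib]
  have hI : ∀ i k, Integrable (fun ω => A i * ((W (f i) ω - ∫ ω', W (f i) ω' ∂P) *
        (W (g i) ω - ∫ ω', W (g i) ω' ∂P)) * (A k * ((W (f k) ω - ∫ ω', W (f k) ω' ∂P) *
        (W (g k) ω - ∫ ω', W (g k) ω' ∂P)))) P := fun i k =>
    ((memLp_centered_mul hW (f i) (g i)).const_mul (A i)).integrable_mul
      ((memLp_centered_mul hW (f k) (g k)).const_mul (A k))
  rw [integral_finsetSum _ fun i _ => integrable_finsetSum _ fun k _ => hI i k]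
  refine Finset.sum_congr rfl fun i _ => ?_
  rw [integral_finsetSum _ fun k _ => hI i k]
  refine Finset.sum_congr rfl fun k _ => ?_
  have h := isserlis hW (f i) (g i) (f k) (g k)
  have e : ∀ ω, A i * ((W (f i) ω - ∫ ω', W (f i) ω' ∂P) *
        (W (g i) ω - ∫ ω', W (g i) ω' ∂P)) * (A k * ((W (f k) ω - ∫ ω', W (f k) ω' ∂P) *
        (W (g k) ω - ∫ ω', W (g k) ω' ∂P))) = A i * A k * (((W (f i) ω - ∫ ω', W (f i) ω' ∂P) *
        (W (g i) ω - ∫ ω', W (g i) ω' ∂P)) * ((W (f k) ω - ∫ ω', W (f k) ω' ∂P) *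
        (W (g k) ω - ∫ ω', W (g k) ω' ∂P))) := fun ω => by ring
  simp only [e]
  rw [integral_const_mul, h]
  ring

lemma integral_quadratic (hW : IsGaussianProcess W P) (S : Finset κ) (A : κ → ℝ)
    (f g : κ → ι) :
    ∫ ω, (∑ i ∈ S, A i * ((W (f i) ω - ∫ ω', W (f i) ω' ∂P) *
        (W (g i) ω - ∫ ω', W (g i) ω' ∂P))) ∂P = ∑ i ∈ S, A i * cov[W (f i), W (g i); P] := by
  have := hW.isProbabilityMeasure
  rw [integral_finsetSum _ fun i _ =>
    ((memLp_centered_mul hW (f i) (g i)).integrable (by norm_num)).const_mul (A i)]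
  refine Finset.sum_congr rfl fun i _ => ?_
  rw [integral_const_mul]
  rfl

lemma memLp_quadratic (hW : IsGaussianProcess W P) (S : Finset κ) (A : κ → ℝ)
    (f g : κ → ι) :
    MemLp (fun ω => ∑ i ∈ S, A i * ((W (f i) ω - ∫ ω', W (f i) ω' ∂P) *
        (W (g i) ω - ∫ ω', W (g i) ω' ∂P))) 2 P :=
  memLp_finsetSum _ fun i _ => (memLp_centered_mul hW (f i) (g i)).const_mul (A i)

end GaussianProcess

/-- Schur's test for a nonnegative kernel on a finite set. -/
lemma sum_sum_mul_le_of_schur {κ : Type*} (S : Finset κ) (x : κ → ℝ) (k : κ → κ → ℝ) (R : ℝ)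
    (hk : ∀ i j, 0 ≤ k i j) (hrow : ∀ i ∈ S, ∑ j ∈ S, k i j ≤ R)
    (hcol : ∀ j ∈ S, ∑ i ∈ S, k i j ≤ R) :
    ∑ i ∈ S, ∑ j ∈ S, |x i * x j| * k i j ≤ R * ∑ i ∈ S, x i ^ 2 := by
  have h1 : ∑ i ∈ S, ∑ j ∈ S, |x i * x j| * k i j ≤
      ∑ i ∈ S, ∑ j ∈ S, (x i ^ 2 / 2 * k i j + x j ^ 2 / 2 * k i j) := by
    refine Finset.sum_le_sum fun i _ => Finset.sum_le_sum fun j _ => ?_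
    rw [← add_mul]
    refine mul_le_mul_of_nonneg_right ?_ (hk i j)
    rw [abs_mul]
    nlinarith [sq_nonneg (|x i| - |x j|), sq_abs (x i), sq_abs (x j)]
  refine h1.trans ?_
  simp only [Finset.sum_add_distrib]
  have h2 : ∑ i ∈ S, ∑ j ∈ S, x i ^ 2 / 2 * k i j ≤ ∑ i ∈ S, x i ^ 2 / 2 * R := by
    refine Finset.sum_le_sum fun i hi => ?_
    rw [← Finset.mul_sum]
    exact mul_le_mul_of_nonneg_left (hrow i hi) (by positivity)
  have h3 : ∑ i ∈ S, ∑ j ∈ S, x j ^ 2 / 2 * k i j ≤ ∑ i ∈ S, x i ^ 2 / 2 * R := by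
    rw [Finset.sum_comm]
    refine Finset.sum_le_sum fun i hi => ?_
    rw [← Finset.mul_sum]
    exact mul_le_mul_of_nonneg_left (hcol i hi) (by positivity)
  calc _ ≤ _ := add_le_add h2 h3
    _ = _ := by rw [← Finset.sum_add_distrib, Finset.mul_sum]
                exact Finset.sum_congr rfl fun i _ => by ring

/-! ### Trigonometric sums and the periodogram at the Fourier frequencies -/

lemma sum_Icc_int_eq_sum_range (n : ℕ) (f : ℤ → ℝ) :
    ∑ t ∈ Finset.Icc (1 : ℤ) n, f t = ∑ i ∈ Finset.range n, f ((i : ℤ) + 1) := by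
  refine Finset.sum_nbij' (fun t => (t - 1).toNat) (fun i => (i : ℤ) + 1) ?_ ?_ ?_ ?_ ?_
  all_goals intro t ht
  all_goals simp only [Finset.mem_Icc, Finset.mem_range] at ht ⊢
  all_goals first | omega | skip
  congr 1
  omega

/-- Multiplying by `2 sin (θ / 2)` telescopes the sum. The end terms differ by a multiple of `2π` in
the argument, and the factor is nonzero because `n` does not divide `k`. -/
lemma sum_cos_eq_zero (n : ℕ) (hn : 0 < n) (k : ℤ) (hk : ¬ (n : ℤ) ∣ k) (φ : ℝ) :
    ∑ t ∈ Finset.Icc (1 : ℤ) n, Real.cos (2 * Real.pi * k / n * t + φ) = 0 := by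
  have hn' : (n : ℝ) ≠ 0 := by positivity
  set θ : ℝ := 2 * Real.pi * k / n with hθ
  have hsin : Real.sin (θ / 2) ≠ 0 := by
    intro h
    obtain ⟨l, hl⟩ := Real.sin_eq_zero_iff.1 h
    apply hk
    refine ⟨l, ?_⟩
    have h1 : (l : ℝ) * Real.pi * n = Real.pi * k := by
      rw [hl, hθ]; field_simp
    have h2 : (k : ℝ) = n * l := by
      apply mul_left_cancel₀ Real.pi_ne_zero
      rw [← h1]; ring
    exact_mod_cast h2
  rw [sum_Icc_int_eq_sum_range]
  have htel : ∀ i : ℕ, 2 * Real.sin (θ / 2) * Real.cos (θ * (((i : ℤ) + 1 : ℤ) : ℝ) + φ) =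
      (fun i : ℕ => Real.sin (θ * i + θ / 2 + φ)) (i + 1) -
        (fun i : ℕ => Real.sin (θ * i + θ / 2 + φ)) i := by
    intro i
    have e1 : θ * ((i + 1 : ℕ) : ℝ) + θ / 2 + φ = (θ * (i + 1) + φ) + θ / 2 := by
      push_cast; ring
    have e2 : θ * (i : ℝ) + θ / 2 + φ = (θ * (i + 1) + φ) - θ / 2 := by ring
    simp only [e1, e2, Real.sin_add, Real.sin_sub]
    push_cast
    simp only [Real.cos_add]
    ring
  have hsum : 2 * Real.sin (θ / 2) *
      ∑ i ∈ Finset.range n, Real.cos (θ * (((i : ℤ) + 1 : ℤ) : ℝ) + φ) = 0 := by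
    rw [Finset.mul_sum, Finset.sum_congr rfl fun i _ => htel i,
      Finset.sum_range_sub (fun i : ℕ => Real.sin (θ * i + θ / 2 + φ))]
    have e3 : θ * (n : ℝ) + θ / 2 + φ = (θ / 2 + φ) + k * (2 * Real.pi) := by
      rw [hθ]; field_simp
      ring
    simp only [e3, Real.sin_add_int_mul_two_pi]
    simp
  rcases mul_eq_zero.1 hsum with h | h
  · exact absurd (by linarith [mul_eq_zero.1 h |>.resolve_left two_ne_zero]) hsin
  · exact h

lemma sum_cos_sub_eq_zero (n : ℕ) (hn : 0 < n) (k : ℤ) (hk : ¬ (n : ℤ) ∣ k) (q : ℤ) :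
    ∑ p ∈ Finset.Icc (1 : ℤ) n, Real.cos (2 * Real.pi * k / n * ((p : ℝ) - q)) = 0 := by
  rw [← sum_cos_eq_zero n hn k hk (-(2 * Real.pi * k / n * q))]
  exact Finset.sum_congr rfl fun p _ => by congr 1; ring

lemma sum_cos_sub_eq_zero' (n : ℕ) (hn : 0 < n) (k : ℤ) (hk : ¬ (n : ℤ) ∣ k) (p : ℤ) :
    ∑ q ∈ Finset.Icc (1 : ℤ) n, Real.cos (2 * Real.pi * k / n * ((p : ℝ) - q)) = 0 := by
  rw [← sum_cos_sub_eq_zero n hn k hk p]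
  refine Finset.sum_congr rfl fun q _ => ?_
  rw [← Real.cos_neg]
  congr 1
  ring

/-- Orthogonality of the cosines at distinct Fourier frequencies in `(0, π]`. -/
lemma sum_sum_sq_cos_le {ι : Type*} [Fintype ι] (n : ℕ) (hn : 0 < n) (s : ι → ℤ)
    (hinj : Function.Injective s) (h1 : ∀ i, 1 ≤ s i) (h2 : ∀ i, 2 * s i ≤ n) (a : ι → ℝ) :
    ∑ p ∈ Finset.Icc (1 : ℤ) n, ∑ q ∈ Finset.Icc (1 : ℤ) n,
      (∑ i, a i * Real.cos (2 * Real.pi * s i / n * ((p : ℝ) - q))) ^ 2 ≤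
        (n : ℝ) ^ 2 * ∑ i, a i ^ 2 := by
  have hortho : ∀ i k, i ≠ k → ∀ q : ℤ, ∑ p ∈ Finset.Icc (1 : ℤ) n,
      Real.cos (2 * Real.pi * s i / n * ((p : ℝ) - q)) *
        Real.cos (2 * Real.pi * s k / n * ((p : ℝ) - q)) = 0 := by
    intro i k hik q
    have hne : s i ≠ s k := fun h => hik (hinj h)
    have hi1 := h1 i
    have hi2 := h2 i
    have hk1 := h1 k
    have hk2 := h2 k
    have d1 : ¬ (n : ℤ) ∣ s i - s k := by
      intro hd
      have := Int.eq_zero_of_abs_lt_dvd hd (by rw [abs_lt]; constructor <;> omega)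
      omega
    -- Distinct indices that are at most `n / 2` have a sum strictly below `n`, so the frequency `π`
    -- causes no exception.
    have d2 : ¬ (n : ℤ) ∣ s i + s k := by
      intro hd
      have := Int.eq_zero_of_abs_lt_dvd hd (by rw [abs_lt]; constructor <;> omega)
      omega
    have e : ∀ p : ℤ, Real.cos (2 * Real.pi * s i / n * ((p : ℝ) - q)) *
        Real.cos (2 * Real.pi * s k / n * ((p : ℝ) - q)) =
        (1 / 2) * Real.cos (2 * Real.pi * (s i - s k : ℤ) / n * ((p : ℝ) - q)) +
        (1 / 2) * Real.cos (2 * Real.pi * (s i + s k : ℤ) / n * ((p : ℝ) - q)) := by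
      intro p
      have e1 : 2 * Real.pi * (s i - s k : ℤ) / n * ((p : ℝ) - q) =
        2 * Real.pi * s i / n * ((p : ℝ) - q) - 2 * Real.pi * s k / n * ((p : ℝ) - q) := by
        push_cast; ring
      have e2 : 2 * Real.pi * (s i + s k : ℤ) / n * ((p : ℝ) - q) =
        2 * Real.pi * s i / n * ((p : ℝ) - q) + 2 * Real.pi * s k / n * ((p : ℝ) - q) := by
        push_cast; ring
      rw [e1, e2, Real.cos_sub, Real.cos_add]
      ring
    simp only [e, Finset.sum_add_distrib, ← Finset.mul_sum,
      sum_cos_sub_eq_zero n hn _ d1, sum_cos_sub_eq_zero n hn _ d2]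
    simp
  have hq : ∀ q ∈ Finset.Icc (1 : ℤ) n, ∑ p ∈ Finset.Icc (1 : ℤ) n,
      (∑ i, a i * Real.cos (2 * Real.pi * s i / n * ((p : ℝ) - q))) ^ 2 ≤ n * ∑ i, a i ^ 2 := by
    intro q _
    simp only [sq, Finset.sum_mul_sum]
    rw [Finset.sum_comm, Finset.mul_sum]
    refine Finset.sum_le_sum fun i _ => ?_
    rw [Finset.sum_comm, Finset.sum_eq_single i]
    -- Bounding the squared cosine by one avoids treating `π` separately, where its average is one
    -- instead of one half.
    · have hle : ∀ p ∈ Finset.Icc (1 : ℤ) n,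
          a i * Real.cos (2 * Real.pi * s i / n * ((p : ℝ) - q)) *
          (a i * Real.cos (2 * Real.pi * s i / n * ((p : ℝ) - q))) ≤ a i * a i := by
        intro p _
        have := Real.cos_sq_le_one (2 * Real.pi * s i / n * ((p : ℝ) - q))
        nlinarith [mul_self_nonneg (a i)]
      refine (Finset.sum_le_sum hle).trans ?_
      simp
    · intro k _ hk
      have := hortho i k hk.symm q
      calc _ = a i * a k * ∑ p ∈ Finset.Icc (1 : ℤ) n,
            Real.cos (2 * Real.pi * s i / n * ((p : ℝ) - q)) *
            Real.cos (2 * Real.pi * s k / n * ((p : ℝ) - q)) := by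
              rw [Finset.mul_sum]
              exact Finset.sum_congr rfl fun p _ => by ring
        _ = 0 := by rw [this, mul_zero]
    · simp
  rw [Finset.sum_comm]
  refine (Finset.sum_le_sum hq).trans ?_
  simp only [Finset.sum_const, Int.card_Icc, nsmul_eq_mul]
  have : (((n : ℤ) + 1 - 1).toNat : ℝ) = n := by simp
  rw [this]
  exact le_of_eq (by ring)

/-- Summation over pairs of times, ordered by lag. -/
lemma sum_lag_eq_sum_sum (n : ℕ) (F : ℤ → ℤ → ℝ) :
    ∑ h ∈ Finset.Ioo (-(n : ℤ)) n,
      ∑ t ∈ (Finset.Icc (1 : ℤ) n).filter (fun t => t + h ∈ Finset.Icc (1 : ℤ) n), F (t + h) t =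
    ∑ p ∈ Finset.Icc (1 : ℤ) n, ∑ q ∈ Finset.Icc (1 : ℤ) n, F p q := by
  rw [Finset.sum_sigma', ← Finset.sum_product']
  refine Finset.sum_bij' (fun x _ => (x.2 + x.1, x.2)) (fun x _ => ⟨x.1 - x.2, x.2⟩)
    ?_ ?_ ?_ ?_ ?_
  · rintro ⟨h, t⟩ hx
    simp only [Finset.mem_sigma, Finset.mem_filter, Finset.mem_product, Finset.mem_Icc] at hx ⊢
    tauto
  · rintro ⟨p, q⟩ hx
    simp only [Finset.mem_sigma, Finset.mem_filter, Finset.mem_product, Finset.mem_Icc,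
      Finset.mem_Ioo] at hx ⊢
    omega
  · rintro ⟨h, t⟩ _
    simp
  · rintro ⟨p, q⟩ _
    simp
  · rintro ⟨h, t⟩ _
    rfl

variable {m : ℕ}

lemma re_periodogram (n : ℕ) (x : ℤ → (Fin m → ℝ)) (w : ℝ) (j k : Fin m) :
    (periodogram n x w j k).re = (2 * Real.pi * n)⁻¹ *
      ∑ p ∈ Finset.Icc (1 : ℤ) n, ∑ q ∈ Finset.Icc (1 : ℤ) n,
        Real.cos (w * ((p : ℝ) - q)) *
          ((x p j - sampleMean n x j) * (x q k - sampleMean n x k)) := by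
  have hexp : ∀ h : ℤ, Complex.exp (-(Complex.I * w * h)) * (sampleAutocov n x j k h : ℂ) =
      ((Real.cos (w * h) * sampleAutocov n x j k h : ℝ) : ℂ) -
        ((Real.sin (w * h) * sampleAutocov n x j k h : ℝ) : ℂ) * Complex.I := by
    intro h
    have : -(Complex.I * w * h) = ((-(w * h) : ℝ) : ℂ) * Complex.I := by push_cast; ring
    rw [this, Complex.exp_mul_I, ← Complex.ofReal_cos, ← Complex.ofReal_sin, Real.cos_neg,
      Real.sin_neg]
    push_cast
    ring
  have hpi : (2 * (Real.pi : ℂ))⁻¹ = (((2 * Real.pi)⁻¹ : ℝ) : ℂ) := by push_cast; ring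
  unfold periodogram
  rw [hpi, Complex.re_ofReal_mul, Complex.re_sum]
  have hre : ∀ h : ℤ, (Complex.exp (-(Complex.I * w * h)) * (sampleAutocov n x j k h : ℂ)).re =
      Real.cos (w * h) * sampleAutocov n x j k h := by
    intro h
    rw [hexp, Complex.sub_re, Complex.ofReal_re, Complex.re_ofReal_mul, Complex.I_re, mul_zero,
      sub_zero]
  simp only [hre]
  rw [← sum_lag_eq_sum_sum n (fun p q => Real.cos (w * ((p : ℝ) - q)) *
          ((x p j - sampleMean n x j) * (x q k - sampleMean n x k))), mul_inv (2 * Real.pi) (n : ℝ), mul_assoc]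
  congr 1
  rw [Finset.mul_sum]
  refine (Finset.sum_congr rfl fun h _ => ?_)
  unfold sampleAutocov
  rw [mul_left_comm, Finset.mul_sum]
  congr 1
  refine Finset.sum_congr rfl fun t _ => ?_
  push_cast
  rw [add_sub_cancel_left]

/-- Rows and columns of the cosine matrix sum to zero at a nonzero Fourier frequency. Hence the
sample mean of the definition may be exchanged for the true mean needed in moment computations. -/
lemma sum_sum_cos_mul_sub (n : ℕ) (hn : 0 < n) (s : ℤ) (hs : ¬ (n : ℤ) ∣ s) (x y : ℤ → ℝ)
    (c d : ℝ) :
    ∑ p ∈ Finset.Icc (1 : ℤ) n, ∑ q ∈ Finset.Icc (1 : ℤ) n,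
        Real.cos (2 * Real.pi * s / n * ((p : ℝ) - q)) * ((x p - c) * (y q - d)) =
    ∑ p ∈ Finset.Icc (1 : ℤ) n, ∑ q ∈ Finset.Icc (1 : ℤ) n,
        Real.cos (2 * Real.pi * s / n * ((p : ℝ) - q)) * (x p * y q) := by
  have e : ∀ p q : ℤ, Real.cos (2 * Real.pi * s / n * ((p : ℝ) - q)) * ((x p - c) * (y q - d)) =
      Real.cos (2 * Real.pi * s / n * ((p : ℝ) - q)) * (x p * y q) -
      (d * (x p - c)) * Real.cos (2 * Real.pi * s / n * ((p : ℝ) - q)) -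
      (c * y q) * Real.cos (2 * Real.pi * s / n * ((p : ℝ) - q)) := fun p q => by ring
  simp only [e, Finset.sum_sub_distrib, ← Finset.mul_sum, sum_cos_sub_eq_zero' n hn s hs]
  rw [Finset.sum_comm (f := fun p q : ℤ =>
    (c * y q) * Real.cos (2 * Real.pi * s / n * ((p : ℝ) - q)))]
  simp only [← Finset.mul_sum, sum_cos_sub_eq_zero n hn s hs]
  simp

/-- At the nonzero Fourier frequencies the periodogram is unaffected by centering. -/
lemma re_periodogram_fourier (n : ℕ) (hn : 0 < n) (x : ℤ → (Fin m → ℝ)) (s : ℤ)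
    (hs : ¬ (n : ℤ) ∣ s) (j k : Fin m) (c d : ℝ) :
    (periodogram n x (2 * Real.pi * s / n) j k).re = (2 * Real.pi * n)⁻¹ *
      ∑ p ∈ Finset.Icc (1 : ℤ) n, ∑ q ∈ Finset.Icc (1 : ℤ) n,
        Real.cos (2 * Real.pi * s / n * ((p : ℝ) - q)) * ((x p j - c) * (x q k - d)) := by
  rw [re_periodogram, sum_sum_cos_mul_sub n hn s hs (fun p => x p j) (fun q => x q k),
    sum_sum_cos_mul_sub n hn s hs (fun p => x p j) (fun q => x q k)]

/-! ### Absolutely convergent trigonometric series with smooth sum -/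

/-- The sum `∑_h e^{-iwh} c(h)`. -/
noncomputable def trigSeries (c : ℤ → ℝ) (w : ℝ) : ℂ :=
  ∑' h : ℤ, Complex.exp (-(Complex.I * w * h)) * (c h : ℂ)

lemma norm_exp_neg_I_mul (w : ℝ) (h : ℤ) : ‖Complex.exp (-(Complex.I * w * h))‖ = 1 := by
  have : -(Complex.I * w * h) = ((-(w * h) : ℝ) : ℂ) * Complex.I := by push_cast; ring
  rw [this, Complex.norm_exp_ofReal_mul_I]

lemma exp_neg_I_mul_eq (w : ℝ) (h : ℤ) : Complex.exp (-(Complex.I * w * h)) =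
    (Real.cos (w * h) : ℂ) - (Real.sin (w * h) : ℂ) * Complex.I := by
  have : -(Complex.I * w * h) = ((-(w * h) : ℝ) : ℂ) * Complex.I := by push_cast; ring
  rw [this, Complex.exp_mul_I, ← Complex.ofReal_cos, ← Complex.ofReal_sin, Real.cos_neg,
    Real.sin_neg]
  push_cast
  ring

lemma summable_trigSeries {c : ℤ → ℝ} (hc : Summable c) (w : ℝ) :
    Summable fun h : ℤ => Complex.exp (-(Complex.I * w * h)) * (c h : ℂ) := by
  refine Summable.of_norm ?_
  simpa [norm_exp_neg_I_mul] using hc.abs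

lemma trigSeries_periodic (c : ℤ → ℝ) : Function.Periodic (trigSeries c) (2 * Real.pi) := by
  intro w
  unfold trigSeries
  refine tsum_congr fun h => ?_
  congr 1
  rw [Complex.exp_eq_exp_iff_exists_int]
  exact ⟨-h, by push_cast; ring⟩

lemma trigSeries_neg (c : ℤ → ℝ) (w : ℝ) :
    trigSeries c (-w) = (starRingEnd ℂ) (trigSeries c w) := by
  unfold trigSeries
  rw [Complex.conj_tsum]
  refine tsum_congr fun h => ?_
  rw [map_mul, ← Complex.exp_conj, Complex.conj_ofReal]
  simp

lemma re_trigSeries {c : ℤ → ℝ} (hc : Summable c) (w : ℝ) :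
    (trigSeries c w).re = ∑' h : ℤ, Real.cos (w * h) * c h := by
  unfold trigSeries
  rw [Complex.re_tsum (summable_trigSeries hc w)]
  refine tsum_congr fun h => ?_
  rw [exp_neg_I_mul_eq, Complex.re_mul_ofReal, Complex.sub_re, Complex.ofReal_re,
    Complex.re_ofReal_mul, Complex.I_re, mul_zero, sub_zero]

lemma integral_exp_I_mul_int (k : ℤ) :
    ∫ w in (0 : ℝ)..(2 * Real.pi), Complex.exp (Complex.I * k * w) =
      if k = 0 then 2 * (Real.pi : ℂ) else 0 := by
  split_ifs with hk
  · subst hk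
    simp
  · have hk' : Complex.I * (k : ℂ) ≠ 0 := mul_ne_zero Complex.I_ne_zero (by exact_mod_cast hk)
    rw [integral_exp_mul_complex hk']
    have : Complex.exp (Complex.I * k * ((2 * Real.pi : ℝ) : ℂ)) = 1 := by
      rw [Complex.exp_eq_one_iff]
      exact ⟨k, by push_cast; ring⟩
    rw [this]
    simp

/-- The coefficients of a trigonometric series are its Fourier coefficients. -/
lemma integral_exp_mul_trigSeries {c : ℤ → ℝ} (hc : Summable c) (k : ℤ) :
    ∫ w in (0 : ℝ)..(2 * Real.pi), Complex.exp (Complex.I * k * w) * trigSeries c w =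
      2 * (Real.pi : ℂ) * c k := by
  have hF : HasSum (fun h : ℤ => ∫ w in (0 : ℝ)..(2 * Real.pi),
      Complex.exp (Complex.I * k * w) * (Complex.exp (-(Complex.I * w * h)) * (c h : ℂ)))
      (∫ w in (0 : ℝ)..(2 * Real.pi), Complex.exp (Complex.I * k * w) * trigSeries c w) := by
    refine intervalIntegral.hasSum_integral_of_dominated_convergence (fun h _ => |c h|)
      (fun h => ?_) (fun h => ?_) ?_ ?_ ?_
    · exact (Continuous.aestronglyMeasurable (by fun_prop))
    · refine Eventually.of_forall fun w _ => ?_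
      have : Complex.exp (Complex.I * k * w) = Complex.exp (-(Complex.I * w * ((-k : ℤ) : ℂ))) := by
        congr 1; push_cast; ring
      rw [this, norm_mul, norm_mul, norm_exp_neg_I_mul, norm_exp_neg_I_mul]
      simp
    · exact Eventually.of_forall fun w _ => hc.abs
    · simp
    · exact Eventually.of_forall fun w _ => (summable_trigSeries hc w).hasSum.mul_left _
  have hterm : ∀ h : ℤ, ∫ w in (0 : ℝ)..(2 * Real.pi),
      Complex.exp (Complex.I * k * w) * (Complex.exp (-(Complex.I * w * h)) * (c h : ℂ)) =
      if h = k then 2 * (Real.pi : ℂ) * c k else 0 := by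
    intro h
    have e : ∀ w : ℝ, Complex.exp (Complex.I * k * w) *
        (Complex.exp (-(Complex.I * w * h)) * (c h : ℂ)) =
        Complex.exp (Complex.I * (k - h : ℤ) * w) * (c h : ℂ) := by
      intro w
      rw [← mul_assoc, ← Complex.exp_add]
      congr 2
      push_cast
      ring
    simp only [e]
    rw [intervalIntegral.integral_mul_const, integral_exp_I_mul_int]
    by_cases hk : h = k
    · subst hk; simp
    · rw [if_neg (by omega), if_neg hk, zero_mul]
  simp only [hterm] at hF
  exact hF.unique (hasSum_ite_eq k _)

/-- Decay of the Fourier coefficients of a smooth periodic function. -/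
lemma exists_pow_mul_norm_fourier_le (N : ℕ) : ∀ G : ℝ → ℂ, ContDiff ℝ N G →
    Function.Periodic G (2 * Real.pi) → ∃ C : ℝ, ∀ k : ℤ, |(k : ℝ)| ^ N *
      ‖∫ w in (0 : ℝ)..(2 * Real.pi), Complex.exp (Complex.I * k * w) * G w‖ ≤ C := by
  induction N with
  | zero =>
    intro G hG _
    obtain ⟨C, hC⟩ := (isCompact_Icc (a := (0 : ℝ)) (b := 2 * Real.pi)).exists_bound_of_continuousOn
      hG.continuous.continuousOn
    refine ⟨C * |2 * Real.pi - 0|, fun k => ?_⟩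
    rw [pow_zero, one_mul]
    refine intervalIntegral.norm_integral_le_of_norm_le_const fun w hw => ?_
    have : Complex.exp (Complex.I * k * w) = Complex.exp (-(Complex.I * w * ((-k : ℤ) : ℂ))) := by
      congr 1; push_cast; ring
    rw [norm_mul, this, norm_exp_neg_I_mul, one_mul]
    rw [Set.uIoc_of_le (by positivity)] at hw
    exact hC w ⟨hw.1.le, hw.2⟩
  | succ N ih =>
    intro G hG hper
    have hG' : ContDiff ℝ N (deriv G) := ContDiff.deriv' (by exact_mod_cast hG)
    have hdiff : Differentiable ℝ G := hG.differentiable (by simp)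
    have hper' : Function.Periodic (deriv G) (2 * Real.pi) := by
      intro w
      rw [← deriv_comp_add_const]
      congr 1
      exact funext hper
    obtain ⟨C, hC⟩ := ih _ hG' hper'
    refine ⟨C, fun k => ?_⟩
    have hderiv : ∀ w : ℝ, HasDerivAt (fun w : ℝ => Complex.exp (Complex.I * k * w))
        (Complex.exp (Complex.I * k * w) * (Complex.I * k)) w := by
      intro w
      have h1 : HasDerivAt (fun w : ℝ => Complex.I * k * (w : ℂ)) (Complex.I * k) w := by
        simpa using (Complex.ofRealCLM.hasDerivAt (x := w)).const_mul (Complex.I * (k : ℂ))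
      exact h1.cexp
    -- Boundary terms cancel by periodicity, so one integration by parts trades a derivative of `G`
    -- for a factor `I * k`.
    have hparts := intervalIntegral.integral_mul_deriv_eq_deriv_mul
      (a := 0) (b := 2 * Real.pi) (u := fun w : ℝ => Complex.exp (Complex.I * k * w)) (v := G)
      (fun w _ => hderiv w) (fun w _ => (hdiff w).hasDerivAt)
      (Continuous.intervalIntegrable (by fun_prop) _ _)
      (hG'.continuous.intervalIntegrable _ _)
    have hb : G (2 * Real.pi) = G 0 := by simpa using hper 0
    have hexp : Complex.exp (Complex.I * k * ((2 * Real.pi : ℝ) : ℂ)) = 1 := by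
      rw [Complex.exp_eq_one_iff]
      exact ⟨k, by push_cast; ring⟩
    have hexp0 : Complex.exp (Complex.I * k * ((0 : ℝ) : ℂ)) = 1 := by simp
    rw [hb, hexp, hexp0, sub_self, zero_sub] at hparts
    have e : ∀ w : ℝ, Complex.exp (Complex.I * k * w) * (Complex.I * k) * G w =
        (Complex.I * k) * (Complex.exp (Complex.I * k * w) * G w) := fun w => by ring
    simp only [e] at hparts
    rw [intervalIntegral.integral_const_mul] at hparts
    have := hC k
    rw [hparts, norm_neg, norm_mul, norm_mul, Complex.norm_I, one_mul, Complex.norm_intCast] at this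
    rw [pow_succ, mul_assoc]
    exact this

/-- Coefficients of a three times continuously differentiable trigonometric series. -/
lemma summable_abs_mul_abs {c : ℤ → ℝ} (hc : Summable c) (hs : ContDiff ℝ 3 (trigSeries c)) :
    Summable fun h : ℤ => |(h : ℝ)| * |c h| := by
  obtain ⟨C, hC⟩ := exists_pow_mul_norm_fourier_le 3 _ (by exact_mod_cast hs)
    (trigSeries_periodic c)
  simp only [integral_exp_mul_trigSeries hc] at hC
  -- Cubic decay of the coefficients leaves this dominating series; at `h = 0` both sides vanish,
  -- with `1 / 0 = 0`.
  have hsum : Summable fun h : ℤ => C / (2 * Real.pi) * (1 / (h : ℝ) ^ 2) :=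
    (Real.summable_one_div_int_pow.2 one_lt_two).mul_left _
  refine hsum.of_nonneg_of_le (fun h => by positivity) fun h => ?_
  by_cases h0 : h = 0
  · subst h0; simp
  have h1 : 0 < |(h : ℝ)| := abs_pos.2 (by exact_mod_cast h0)
  have h2 := hC h
  rw [norm_mul, norm_mul, Complex.norm_real, Complex.norm_real, Real.norm_eq_abs, Real.norm_eq_abs,
    abs_of_pos Real.pi_pos, Complex.norm_ofNat] at h2
  rw [← sq_abs (h : ℝ), div_mul_div_comm, mul_one, le_div_iff₀ (by positivity)]
  calc _ = |(h : ℝ)| ^ 3 * (2 * Real.pi * |c h|) := by ring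
    _ ≤ C := h2

lemma card_filter_lag (n : ℕ) (h : ℤ) (hh : h ∈ Finset.Ioo (-(n : ℤ)) n) :
    (((Finset.Icc (1 : ℤ) n).filter (fun t => t + h ∈ Finset.Icc (1 : ℤ) n)).card : ℝ) =
      n - |(h : ℝ)| := by
  have : (Finset.Icc (1 : ℤ) n).filter (fun t => t + h ∈ Finset.Icc (1 : ℤ) n) =
      Finset.Icc (max 1 (1 - h)) (min n (n - h)) := by
    ext t
    simp only [Finset.mem_filter, Finset.mem_Icc, max_le_iff, le_min_iff]
    constructor <;> intro H <;> refine ⟨⟨?_, ?_⟩, ?_, ?_⟩ <;> omega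
  rw [this, Int.card_Icc]
  rw [Finset.mem_Ioo] at hh
  have h2 : ((min (n : ℤ) (n - h) + 1 - max 1 (1 - h)).toNat : ℤ) = n - |h| := by
    rcases le_total 0 h with h0 | h0
    · rw [abs_of_nonneg h0]; omega
    · rw [abs_of_nonpos h0]; omega
  exact_mod_cast h2

/-- The Cesàro means of a trigonometric series converge at rate `1 / n`. -/
lemma abs_cesaro_sub_le {c : ℤ → ℝ} (hc : Summable c)
    (hs : Summable fun h : ℤ => |(h : ℝ)| * |c h|) (n : ℕ) (hn : 0 < n) (w : ℝ) :
    |(n : ℝ)⁻¹ * ∑ p ∈ Finset.Icc (1 : ℤ) n, ∑ q ∈ Finset.Icc (1 : ℤ) n,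
        Real.cos (w * ((p : ℝ) - q)) * c (p - q) - (trigSeries c w).re| ≤
      (∑' h : ℤ, |(h : ℝ)| * |c h|) / n := by
  have hn' : (0 : ℝ) < n := by exact_mod_cast hn
  have e1 : ∑ p ∈ Finset.Icc (1 : ℤ) n, ∑ q ∈ Finset.Icc (1 : ℤ) n,
        Real.cos (w * ((p : ℝ) - q)) * c (p - q) =
      ∑ h ∈ Finset.Ioo (-(n : ℤ)) n, (n - |(h : ℝ)|) * (Real.cos (w * h) * c h) := by
    rw [← sum_lag_eq_sum_sum n (fun p q => Real.cos (w * ((p : ℝ) - q)) * c (p - q))]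
    refine Finset.sum_congr rfl fun h hh => ?_
    rw [← card_filter_lag n h hh, ← nsmul_eq_mul, ← Finset.sum_const]
    refine Finset.sum_congr rfl fun t _ => ?_
    push_cast
    rw [add_sub_cancel_left, add_sub_cancel_left]
  -- The triangular weights `1 - |h| / n`, extended by zero. The error at each lag is then at most
  -- `|h| / n * |c h|`: by the weight itself when `|h| < n`, and because `1 ≤ |h| / n` otherwise.
  set r : ℤ → ℝ := fun h => if h ∈ Finset.Ioo (-(n : ℤ)) n then
    (n : ℝ)⁻¹ * ((n - |(h : ℝ)|) * (Real.cos (w * h) * c h)) else 0 with hr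
  have e2 : (n : ℝ)⁻¹ * ∑ p ∈ Finset.Icc (1 : ℤ) n, ∑ q ∈ Finset.Icc (1 : ℤ) n,
        Real.cos (w * ((p : ℝ) - q)) * c (p - q) = ∑' h, r h := by
    rw [e1, Finset.mul_sum, tsum_eq_sum (s := Finset.Ioo (-(n : ℤ)) n)
      (fun h hh => by simp only [hr, if_neg hh])]
    exact Finset.sum_congr rfl fun h hh => by simp only [hr, if_pos hh]
  have hrs : Summable r := summable_of_ne_finset_zero (s := Finset.Ioo (-(n : ℤ)) n)
    (fun h hh => by simp only [hr, if_neg hh])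
  have hcs : Summable fun h : ℤ => Real.cos (w * h) * c h := by
    refine Summable.of_norm_bounded hc.abs fun h => ?_
    rw [Real.norm_eq_abs, abs_mul]
    exact mul_le_of_le_one_left (abs_nonneg _) (Real.abs_cos_le_one _)
  rw [e2, re_trigSeries hc, ← hrs.tsum_sub hcs, ← Real.norm_eq_abs, div_eq_mul_inv, ← tsum_mul_right]
  refine tsum_of_norm_bounded (hs.mul_right _).hasSum fun h => ?_
  have hcos : |Real.cos (w * h) * c h| ≤ |c h| := by
    rw [abs_mul]
    exact mul_le_of_le_one_left (abs_nonneg _) (Real.abs_cos_le_one _)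
  rw [Real.norm_eq_abs]
  by_cases hh : h ∈ Finset.Ioo (-(n : ℤ)) n
  · simp only [hr, if_pos hh]
    have : (n : ℝ)⁻¹ * ((n - |(h : ℝ)|) * (Real.cos (w * h) * c h)) - Real.cos (w * h) * c h =
        -(|(h : ℝ)| * (n : ℝ)⁻¹ * (Real.cos (w * h) * c h)) := by field_simp; ring
    rw [this, abs_neg, abs_mul, abs_of_nonneg (by positivity : 0 ≤ |(h : ℝ)| * (n : ℝ)⁻¹)]
    calc _ ≤ |(h : ℝ)| * (n : ℝ)⁻¹ * |c h| := by gcongr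
      _ = _ := by ring
  · simp only [hr, if_neg hh]
    rw [zero_sub, abs_neg]
    refine hcos.trans ?_
    have hge : (n : ℝ) ≤ |(h : ℝ)| := by
      have : (n : ℤ) ≤ |h| := by
        rw [Finset.mem_Ioo, not_and_or] at hh
        rcases hh with hh | hh
        · exact le_abs.2 (Or.inr (by omega))
        · exact le_abs.2 (Or.inl (by omega))
      exact_mod_cast this
    calc |c h| = 1 * |c h| := (one_mul _).symm
      _ ≤ (|(h : ℝ)| * (n : ℝ)⁻¹) * |c h| := by
        gcongr
        rw [← div_eq_mul_inv, le_div_iff₀ hn', one_mul]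
        exact hge
      _ = _ := by ring

/-- Fourth order Taylor expansion of an even function. -/
lemma exists_taylor_even {g : ℝ → ℝ} (hg : ContDiff ℝ 4 g) (heven : ∀ x, g (-x) = g x) (b : ℝ)
    (hb : 0 < b) : ∃ A C : ℝ, ∀ x ∈ Set.Icc 0 b, |g x - (g 0 + A * x ^ 2)| ≤ C * x ^ 4 := by
  obtain ⟨C, hC⟩ := exists_taylor_mean_remainder_bound (f := g) (n := 3) hb.le
    (by norm_num; exact hg.contDiffOn)
  -- Evenness removes the linear and cubic terms, so a third order expansion has a quartic
  -- remainder.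
  have hodd : ∀ i : ℕ, Odd i → iteratedDeriv i g 0 = 0 := by
    intro i hi
    have h := iteratedDeriv_comp_neg i g 0
    simp only [heven, neg_zero, hi.neg_one_pow] at h
    simp only [smul_eq_mul, neg_mul, one_mul] at h
    linarith
  have hw : ∀ i : ℕ, i ≤ 4 → iteratedDerivWithin i g (Set.Icc 0 b) 0 = iteratedDeriv i g 0 := by
    intro i hi
    refine iteratedDerivWithin_eq_iteratedDeriv (uniqueDiffOn_Icc hb) ?_ ⟨le_rfl, hb.le⟩
    exact (hg.of_le (by exact_mod_cast hi)).contDiffAt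
  refine ⟨iteratedDeriv 2 g 0 / 2, C, fun x hx => ?_⟩
  have h := hC x hx
  rw [taylor_within_apply] at h
  simp only [Finset.sum_range_succ, Finset.sum_range_zero, hw 0 (by norm_num), hw 1 (by norm_num),
    hw 2 (by norm_num), hw 3 (by norm_num), hodd 1 (by decide), hodd 3 (by decide)] at h
  simp only [iteratedDeriv_zero, sub_zero, Real.norm_eq_abs, smul_eq_mul, Nat.factorial] at h
  norm_num at h
  convert h using 3
  ring

/-! ### Expansion of the spectral density around the frequencies `0` and `± π` -/

/-- This singles out `0` and `± π`: the reflection `w ↦ 2|θ| - w` agrees with `w ↦ -w` modulo the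
period. -/
lemma exists_int_two_mul_abs {θ : ℝ} (hθ : θ = 0 ∨ θ = Real.pi ∨ θ = -Real.pi) :
    ∃ l : ℤ, 2 * |θ| = l * (2 * Real.pi) := by
  rcases hθ with rfl | rfl | rfl
  · exact ⟨0, by simp⟩
  · exact ⟨1, by rw [abs_of_pos Real.pi_pos]; simp⟩
  · exact ⟨1, by rw [abs_neg, abs_of_pos Real.pi_pos]; simp⟩

lemma trigSeries_add_int_mul (c : ℤ → ℝ) (w : ℝ) (l : ℤ) :
    trigSeries c (w + l * (2 * Real.pi)) = trigSeries c w :=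
  (trigSeries_periodic c).int_mul l w

lemma trigSeries_abs (c : ℤ → ℝ) {θ : ℝ} (hθ : θ = 0 ∨ θ = Real.pi ∨ θ = -Real.pi) :
    trigSeries c |θ| = trigSeries c θ := by
  obtain ⟨l, hl⟩ := exists_int_two_mul_abs hθ
  rcases abs_cases θ with ⟨h, _⟩ | ⟨h, _⟩
  · rw [h]
  · rw [← trigSeries_add_int_mul c θ l, ← hl, h]
    congr 1
    ring

lemma im_trigSeries_eq_zero (c : ℤ → ℝ) {θ : ℝ}
    (hθ : θ = 0 ∨ θ = Real.pi ∨ θ = -Real.pi) : (trigSeries c θ).im = 0 := by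
  obtain ⟨l, hl⟩ := exists_int_two_mul_abs hθ
  rw [← trigSeries_abs c hθ]
  have h := trigSeries_neg c |θ|
  have h2 : trigSeries c (-|θ|) = trigSeries c |θ| := by
    rw [← trigSeries_add_int_mul c (-|θ|) l, ← hl]
    congr 1
    ring
  rw [h2] at h
  have h3 := congrArg Complex.im h
  rw [Complex.conj_im] at h3
  linarith

/-- Reflection in `|θ|` conjugates the series, so its real part is even about `|θ|`. Distances up to
`π` suffice because `2πδ < π` when `δ < 1 / 2`. -/
lemma exists_trigSeries_expansion (c : ℤ → ℝ) (hs : ContDiff ℝ 4 (trigSeries c)) {θ : ℝ}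
    (hθ : θ = 0 ∨ θ = Real.pi ∨ θ = -Real.pi) :
    ∃ A C : ℝ, 0 ≤ C ∧ ∀ w : ℝ, |(|θ| - w)| ≤ Real.pi →
      |(trigSeries c w).re - ((trigSeries c θ).re + A * |(|θ| - w)| ^ 2)| ≤
        C * |(|θ| - w)| ^ 4 := by
  obtain ⟨l, hl⟩ := exists_int_two_mul_abs hθ
  set g : ℝ → ℝ := fun x => (trigSeries c (|θ| + x)).re with hg
  have hg4 : ContDiff ℝ 4 g := by
    have h1 : ContDiff ℝ 4 fun x : ℝ => trigSeries c (|θ| + x) :=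
      hs.comp (contDiff_const.add contDiff_id)
    exact Complex.reCLM.contDiff.comp h1
  have heven : ∀ x, g (-x) = g x := by
    intro x
    have : trigSeries c (|θ| + -x) = (starRingEnd ℂ) (trigSeries c (|θ| + x)) := by
      rw [← trigSeries_neg, ← trigSeries_add_int_mul c (-(|θ| + x)) l, ← hl]
      congr 1
      ring
    simp only [hg, this, Complex.conj_re]
  obtain ⟨A, C, hC⟩ := exists_taylor_even hg4 heven Real.pi Real.pi_pos
  have hC0 : 0 ≤ C := by
    have h := hC Real.pi ⟨Real.pi_pos.le, le_rfl⟩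
    by_contra hneg
    have : C * Real.pi ^ 4 < 0 := mul_neg_of_neg_of_pos (not_le.1 hneg) (by positivity)
    exact absurd (h.trans_lt this) (not_lt.2 (abs_nonneg _))
  refine ⟨A, C, hC0, fun w hw => ?_⟩
  have h := hC |(|θ| - w)| ⟨abs_nonneg _, hw⟩
  have h0 : g 0 = (trigSeries c θ).re := by simp only [hg, add_zero, trigSeries_abs c hθ]
  have h1 : g |(|θ| - w)| = (trigSeries c w).re := by
    rcases abs_cases (|θ| - w) with ⟨h, _⟩ | ⟨h, _⟩
    · rw [h, ← heven]
      simp only [hg]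
      congr 2
      ring
    · rw [h]
      simp only [hg]
      congr 2
      ring
  rwa [h0, h1] at h

/-! ### The weights of the local quadratic regression -/

/-- A kernel with positive integral is nonzero at some continuity point in the interior, and stays
above half its value there on an interval to the right. Length `3 * h` leaves room for two outer
thirds separated by a gap `h`. -/
lemma IsKernel.exists_lower_bound {K : ℝ → ℝ} (hK : IsKernel K) :
    ∃ a h κ : ℝ, 0 < a ∧ 0 < h ∧ a + 3 * h < 1 ∧ 0 < κ ∧
      ∀ x ∈ Set.Icc a (a + 3 * h), κ ≤ K x := by
  have hne : ∃ x ∈ Set.Ioo (0 : ℝ) 1, ContinuousAt K x ∧ K x ≠ 0 := by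
    by_contra hcon
    push Not at hcon
    have hae : ∀ᵐ x ∂(volume.restrict (Set.Ioo (0 : ℝ) 1)), K x = 0 := by
      have h1 := ae_restrict_of_ae_restrict_of_subset (Set.Ioo_subset_Icc_self) hK.ae_continuousAt
      filter_upwards [h1, ae_restrict_mem measurableSet_Ioo] with x hx hx'
      exact hcon x hx' hx
    have hint : ∫ x in (0 : ℝ)..1, K x = 0 := by
      rw [intervalIntegral.integral_of_le zero_le_one, integral_Ioc_eq_integral_Ioo]
      exact integral_eq_zero_of_ae hae
    exact hK.integral_pos.ne' hint
  obtain ⟨x, hx, hcx, hKx⟩ := hne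
  have hpos : 0 < K x := lt_of_le_of_ne (hK.nonneg x ⟨hx.1.le, hx.2.le⟩) hKx.symm
  have hev : ∀ᶠ y in 𝓝 x, K x / 2 < K y ∧ y < 1 :=
    (hcx.eventually (lt_mem_nhds (by linarith))).and (gt_mem_nhds hx.2)
  obtain ⟨ε, hε, hball⟩ := Metric.eventually_nhds_iff.1 hev
  refine ⟨x, ε / 6, K x / 2, hx.1, by positivity, ?_, by positivity, fun y hy => ?_⟩
  · refine (hball (y := x + 3 * (ε / 6)) ?_).2
    rw [Real.dist_eq, add_sub_cancel_left, abs_of_pos (by positivity)]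
    linarith
  · refine (hball (y := y) ?_).1.le
    rw [Real.dist_eq, abs_of_nonneg (by linarith [hy.1])]
    linarith [hy.2]

/-- Turns the Gram determinant into a sum of nonnegative terms over pairs, which can be bounded
below by discarding pairs. -/
lemma lagrange_identity {ι : Type*} [Fintype ι] (k u : ι → ℝ) :
    ∑ i, ∑ l, k i * k l * (u i ^ 2 - u l ^ 2) ^ 2 =
      2 * ((∑ i, k i) * (∑ i, k i * u i ^ 4) - (∑ i, k i * u i ^ 2) ^ 2) := by
  have e : ∀ i l, k i * k l * (u i ^ 2 - u l ^ 2) ^ 2 =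
      (k i * u i ^ 4) * k l + k i * (k l * u l ^ 4) -
        2 * ((k i * u i ^ 2) * (k l * u l ^ 2)) := fun i l => by ring
  simp only [e, Finset.sum_add_distrib, Finset.sum_sub_distrib, ← Finset.mul_sum,
    ← Finset.sum_mul]
  ring

/-- Number of equally spaced points in an interval. -/
lemma le_card_filter_grid {M : ℕ} {N e α β : ℝ} (hN : 0 < N) (hM : M = ⌊N⌋₊)
    (he1 : e ≤ 1) (he0 : 0 ≤ e) (hα : 1 ≤ N * α) (hαβ : α ≤ β) (hβ : N * β ≤ N - 1)
    (u : Fin M → ℝ) (σ : Fin M → Fin M) (hσ : Function.Injective σ)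
    (hu : ∀ l, u (σ l) = ((l : ℕ) + e) / N) :
    N * (β - α) - 1 ≤
      ((Finset.univ.filter fun i : Fin M => α ≤ u i ∧ u i ≤ β).card : ℝ) := by
  -- The indices whose grid point lies in `[α, β]`. The assumption on `α` keeps the argument of the
  -- ceiling nonnegative, the one on `β` keeps the indices below `M`.
  set I := Finset.Icc ⌈N * α - e⌉₊ ⌊N * β - e⌋₊ with hI
  have hβe : 0 ≤ N * β - e := by nlinarith
  have hlt : ∀ l ∈ I, l < M := by
    intro l hl
    rw [hI, Finset.mem_Icc] at hl
    have h1 : (l : ℝ) ≤ N * β - e := (Nat.cast_le.2 hl.2).trans (Nat.floor_le hβe)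
    have h2 : (l : ℝ) + 1 ≤ N := by linarith
    rw [hM]
    exact Nat.lt_of_succ_le (Nat.le_floor (by push_cast; exact h2))
  have hcard : (I.card : ℝ) ≤
      ((Finset.univ.filter fun i : Fin M => α ≤ u i ∧ u i ≤ β).card : ℝ) := by
    rw [Nat.cast_le, ← Finset.card_attach]
    refine Finset.card_le_card_of_injOn (fun l => σ ⟨l.1, hlt l.1 l.2⟩) ?_ ?_
    · intro l _
      have hl := Finset.mem_Icc.1 l.2
      have h1 : (l.1 : ℝ) ≤ N * β - e := (Nat.cast_le.2 hl.2).trans (Nat.floor_le hβe)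
      have h2 : N * α - e ≤ l.1 := (Nat.le_ceil _).trans (Nat.cast_le.2 hl.1)
      simp only [Finset.coe_filter, Finset.mem_univ, true_and, Set.mem_ofPred_eq, hu]
      rw [le_div_iff₀ hN, div_le_iff₀ hN]
      constructor <;> linarith
    · intro l _ l' _ hll
      have := hσ hll
      simp only [Fin.mk.injEq] at this
      exact Subtype.ext this
  refine le_trans ?_ hcard
  rw [hI, Nat.card_Icc]
  have h1 : N * β - e < ⌊N * β - e⌋₊ + 1 := Nat.lt_floor_add_one _
  have h2 : (⌈N * α - e⌉₊ : ℝ) < N * α - e + 1 := Nat.ceil_lt_add_one (by linarith)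
  have h3 : ((⌊N * β - e⌋₊ + 1 : ℕ) : ℝ) - (⌈N * α - e⌉₊ : ℝ) ≤
      ((⌊N * β - e⌋₊ + 1 - ⌈N * α - e⌉₊ : ℕ) : ℝ) := by
    rw [sub_le_iff_le_add]
    have : ⌊N * β - e⌋₊ + 1 ≤ (⌊N * β - e⌋₊ + 1 - ⌈N * α - e⌉₊) + ⌈N * α - e⌉₊ := by omega
    exact_mod_cast this
  push_cast at h3
  linarith

/-- Among the pairs in Lagrange's identity, keep those with one point in each outer third of the
interval where `K ≥ κ`. Each third holds at least `N * h / 2` points, and the squares of the two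
points differ by at least `h ^ 2`. -/
lemma IsKernel.exists_gram_lower_bound {K : ℝ → ℝ} (hK : IsKernel K) :
    ∃ c L : ℝ, 0 < c ∧ 0 < L ∧ ∀ (M : ℕ) (N e : ℝ), L ≤ N → M = ⌊N⌋₊ → 0 ≤ e → e ≤ 1 →
      ∀ (u : Fin M → ℝ) (σ : Fin M → Fin M), Function.Injective σ →
      (∀ l, u (σ l) = ((l : ℕ) + e) / N) → (∀ i, u i ∈ Set.Icc (0 : ℝ) 1) →
      c * N ^ 2 ≤ (∑ i, K (u i)) * (∑ i, K (u i) * u i ^ 4) - (∑ i, K (u i) * u i ^ 2) ^ 2 := by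
  obtain ⟨a, h, κ, ha, hh, hab, hκ, hlow⟩ := hK.exists_lower_bound
  -- The three lower bounds on `N` give `N * a ≥ 1`, `N * (a + 3 * h) ≤ N - 1`, and `N * h - 1 ≥ N *
  -- h / 2`.
  refine ⟨κ ^ 2 * h ^ 4 * (h / 2) ^ 2 / 2, max (1 / a) (max (1 / (1 - (a + 3 * h))) (2 / h)),
    by positivity, by positivity, ?_⟩
  intro M N e hN hM he0 he1 u σ hσ hu hu01
  obtain ⟨hN1, hN2, hN3⟩ : 1 / a ≤ N ∧ 1 / (1 - (a + 3 * h)) ≤ N ∧ 2 / h ≤ N := by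
    simpa [max_le_iff] using hN
  rw [div_le_iff₀ ha] at hN1
  rw [div_le_iff₀ (by linarith)] at hN2
  rw [div_le_iff₀ hh] at hN3
  have hNpos : 0 < N := by
    by_contra hneg
    nlinarith
  set I1 := Finset.univ.filter fun i : Fin M => a ≤ u i ∧ u i ≤ a + h with hI1
  set I2 := Finset.univ.filter fun i : Fin M => a + 2 * h ≤ u i ∧ u i ≤ a + 3 * h with hI2
  have hc1 : N * (h / 2) ≤ I1.card := by
    have := le_card_filter_grid (α := a) (β := a + h) hNpos hM he1 he0 (by linarith) (by linarith)
      (by nlinarith) u σ hσ hu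
    rw [← hI1] at this
    refine le_trans ?_ this
    linarith
  have hc2 : N * (h / 2) ≤ I2.card := by
    have := le_card_filter_grid (α := a + 2 * h) (β := a + 3 * h) hNpos hM he1 he0 (by nlinarith)
      (by linarith) (by nlinarith) u σ hσ hu
    rw [← hI2] at this
    refine le_trans ?_ this
    linarith
  have hKn : ∀ i, 0 ≤ K (u i) := fun i => hK.nonneg _ (hu01 i)
  have hterm : ∀ i l, 0 ≤ K (u i) * K (u l) * (u i ^ 2 - u l ^ 2) ^ 2 := fun i l =>
    mul_nonneg (mul_nonneg (hKn i) (hKn l)) (sq_nonneg _)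
  have hlower : ∑ i ∈ I1, ∑ l ∈ I2, κ ^ 2 * h ^ 4 ≤
      ∑ i, ∑ l, K (u i) * K (u l) * (u i ^ 2 - u l ^ 2) ^ 2 := by
    calc ∑ i ∈ I1, ∑ l ∈ I2, κ ^ 2 * h ^ 4
        ≤ ∑ i ∈ I1, ∑ l ∈ I2, K (u i) * K (u l) * (u i ^ 2 - u l ^ 2) ^ 2 := by
          refine Finset.sum_le_sum fun i hi => Finset.sum_le_sum fun l hl => ?_
          rw [hI1, Finset.mem_filter] at hi
          rw [hI2, Finset.mem_filter] at hl
          have k1 : κ ≤ K (u i) := hlow _ ⟨by linarith [hi.2.1], by linarith [hi.2.2]⟩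
          have k2 : κ ≤ K (u l) := hlow _ ⟨by linarith [hl.2.1], by linarith [hl.2.2]⟩
          have k3 : κ ^ 2 ≤ K (u i) * K (u l) := by nlinarith
          have k4 : h ^ 2 ≤ u l ^ 2 - u i ^ 2 := by nlinarith [hi.2.1, hi.2.2, hl.2.1, hl.2.2]
          have k5 : h ^ 4 ≤ (u i ^ 2 - u l ^ 2) ^ 2 := by nlinarith [sq_nonneg h]
          exact mul_le_mul k3 k5 (by positivity) (mul_nonneg (hKn i) (hKn l))
      _ ≤ ∑ i ∈ I1, ∑ l, K (u i) * K (u l) * (u i ^ 2 - u l ^ 2) ^ 2 :=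
          Finset.sum_le_sum fun i _ => Finset.sum_le_sum_of_subset_of_nonneg
            (Finset.subset_univ _) fun l _ _ => hterm i l
      _ ≤ _ := Finset.sum_le_sum_of_subset_of_nonneg (Finset.subset_univ _) fun i _ _ =>
          Finset.sum_nonneg fun l _ => hterm i l
  rw [lagrange_identity] at hlower
  simp only [Finset.sum_const, nsmul_eq_mul] at hlower
  have hprod : (N * (h / 2)) * (N * (h / 2)) ≤ (I1.card : ℝ) * I2.card :=
    mul_le_mul hc1 hc2 (by positivity) (by positivity)
  have : (N * (h / 2)) * (N * (h / 2)) * (κ ^ 2 * h ^ 4) ≤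
      (I1.card : ℝ) * I2.card * (κ ^ 2 * h ^ 4) :=
    mul_le_mul_of_nonneg_right hprod (by positivity)
  nlinarith

/-- The integer `s` such that the `i`th regression frequency is `2πs/n`. -/
noncomputable def regIndex (θ : ℝ) (n : ℕ) (δ : ℝ) (i : Fin (numFreq n δ)) : ℤ :=
  if θ = 0 then (i : ℤ) + 1 else ((n / 2 : ℕ) : ℤ) - numFreq n δ + 1 + i

lemma regFreq_eq (θ : ℝ) (n : ℕ) (δ : ℝ) (i : Fin (numFreq n δ)) :
    regFreq θ n δ i = 2 * Real.pi * (regIndex θ n δ i : ℝ) / n := rfl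

lemma regIndex_injective (θ : ℝ) (n : ℕ) (δ : ℝ) : Function.Injective (regIndex θ n δ) := by
  intro i k h
  unfold regIndex at h
  ext
  split_ifs at h <;> omega

lemma numFreq_le_half {n : ℕ} {δ : ℝ} (hδ0 : 0 < δ) (hδ : δ < 1 / 2) : numFreq n δ ≤ n / 2 := by
  have h1 : (numFreq n δ : ℝ) ≤ δ * n := Nat.floor_le (by positivity)
  have h2 : (2 * numFreq n δ : ℝ) ≤ n := by nlinarith [(Nat.cast_nonneg n : (0 : ℝ) ≤ n)]
  have h3 : 2 * numFreq n δ ≤ n := by exact_mod_cast h2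
  omega

lemma one_le_regIndex (θ : ℝ) {n : ℕ} {δ : ℝ} (hδ0 : 0 < δ) (hδ : δ < 1 / 2)
    (i : Fin (numFreq n δ)) : 1 ≤ regIndex θ n δ i := by
  have := numFreq_le_half (n := n) hδ0 hδ
  unfold regIndex
  split_ifs <;> omega

lemma two_mul_regIndex_le (θ : ℝ) {n : ℕ} {δ : ℝ} (hδ0 : 0 < δ) (hδ : δ < 1 / 2)
    (i : Fin (numFreq n δ)) : 2 * regIndex θ n δ i ≤ n := by
  have := numFreq_le_half (n := n) hδ0 hδ
  have := i.2
  unfold regIndex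
  split_ifs <;> omega

/-- Both designs become one grid with an offset. For `θ = 0` the offset is one, as frequency zero is
skipped. For `± π` the order is reversed and the offset is the fractional part of `n / 2`. -/
lemma exists_regDist_grid {θ : ℝ} (hθ : θ = 0 ∨ θ = Real.pi ∨ θ = -Real.pi) {n : ℕ} {δ : ℝ}
    (hδ0 : 0 < δ) (hn : 0 < n) :
    ∃ (e : ℝ) (σ : Fin (numFreq n δ) → Fin (numFreq n δ)), 0 ≤ e ∧ e ≤ 1 ∧
      Function.Bijective σ ∧ ∀ l, regDist θ n δ (σ l) / (2 * Real.pi * δ) =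
        ((l : ℕ) + e) / (δ * n) := by
  have hπ := Real.pi_pos
  have hn' : (0 : ℝ) < n := by exact_mod_cast hn
  by_cases h0 : θ = 0
  · refine ⟨1, id, zero_le_one, le_rfl, Function.bijective_id, fun l => ?_⟩
    subst h0
    rw [regDist, regFreq_eq, abs_zero, zero_sub, abs_neg, regIndex, if_pos rfl, id]
    rw [abs_of_nonneg (by push_cast; positivity)]
    push_cast
    field_simp
  · have habs : |θ| = Real.pi := by
      rcases hθ with h | h | h
      · exact absurd h h0
      · rw [h, abs_of_pos hπ]
      · rw [h, abs_neg, abs_of_pos hπ]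
    have hdiv : (2 * (n / 2 : ℕ) : ℝ) ≤ n := by exact_mod_cast (by omega : 2 * (n / 2) ≤ n)
    have hdiv' : (n : ℝ) ≤ 2 * (n / 2 : ℕ) + 2 := by
      exact_mod_cast (by omega : n ≤ 2 * (n / 2) + 2)
    refine ⟨(n : ℝ) / 2 - (n / 2 : ℕ), Fin.rev, by linarith, by linarith, Fin.rev_bijective,
      fun l => ?_⟩
    have hs : (regIndex θ n δ (Fin.rev l) : ℝ) = ((n / 2 : ℕ) : ℝ) - (l : ℕ) := by
      have : regIndex θ n δ (Fin.rev l) = ((n / 2 : ℕ) : ℤ) - (l : ℕ) := by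
        have := l.2
        rw [regIndex, if_neg h0, Fin.val_rev]
        omega
      rw [this]
      push_cast
      rfl
    have hl : (0 : ℝ) ≤ (l : ℕ) := Nat.cast_nonneg _
    have e1 : Real.pi - 2 * Real.pi * (((n / 2 : ℕ) : ℝ) - (l : ℕ)) / n =
        2 * Real.pi / n * ((l : ℕ) + ((n : ℝ) / 2 - (n / 2 : ℕ))) := by
      field_simp
      ring
    rw [regDist, regFreq_eq, hs, habs, e1, abs_of_nonneg]
    · field_simp
    · have : 0 ≤ (n : ℝ) / 2 - (n / 2 : ℕ) := by linarith
      positivity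

lemma regDist_div_mem_Icc {θ : ℝ} (hθ : θ = 0 ∨ θ = Real.pi ∨ θ = -Real.pi) {n : ℕ} {δ : ℝ}
    (hδ0 : 0 < δ) (hn : 0 < n) (i : Fin (numFreq n δ)) :
    regDist θ n δ i / (2 * Real.pi * δ) ∈ Set.Icc (0 : ℝ) 1 := by
  obtain ⟨e, σ, he0, he1, hσ, hu⟩ := exists_regDist_grid hθ hδ0 hn
  obtain ⟨l, rfl⟩ := hσ.2 i
  have hn' : (0 : ℝ) < n := by exact_mod_cast hn
  rw [hu l]
  refine ⟨by positivity, ?_⟩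
  rw [div_le_one (by positivity)]
  have h1 : ((numFreq n δ : ℕ) : ℝ) ≤ δ * n := Nat.floor_le (by positivity)
  have h2 : ((l : ℕ) : ℝ) + 1 ≤ (numFreq n δ : ℕ) := by exact_mod_cast l.2
  linarith

lemma regDist_le {θ : ℝ} (hθ : θ = 0 ∨ θ = Real.pi ∨ θ = -Real.pi) {n : ℕ} {δ : ℝ}
    (hδ0 : 0 < δ) (hn : 0 < n) (i : Fin (numFreq n δ)) :
    regDist θ n δ i ≤ 2 * Real.pi * δ := by
  have h := (regDist_div_mem_Icc hθ hδ0 hn i).2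
  rwa [div_le_one (by have := Real.pi_pos; positivity)] at h

/-- The coefficients expressing the regression intercept linearly in the responses. -/
noncomputable def wlsCoeff (K : ℝ → ℝ) (θ : ℝ) (n : ℕ) (δ : ℝ) (i : Fin (numFreq n δ)) : ℝ :=
  (((designMatrix θ n δ)ᵀ * weightMatrix K θ n δ * designMatrix θ n δ)⁻¹ *
    ((designMatrix θ n δ)ᵀ * weightMatrix K θ n δ)) 0 i

lemma localQuad_eq_sum {m : ℕ} (K : ℝ → ℝ) (θ : ℝ) (n : ℕ) (δ : ℝ) (x : ℤ → (Fin m → ℝ))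
    (j k : Fin m) :
    localQuad K θ n δ x j k = ∑ i, wlsCoeff K θ n δ i * (periodogram n x (regFreq θ n δ i) j k).re := by
  unfold localQuad
  rw [Matrix.mulVec_mulVec, Matrix.mulVec_mulVec, Matrix.mul_assoc]
  rfl

lemma gram_apply (K : ℝ → ℝ) (θ : ℝ) (n : ℕ) (δ : ℝ) :
    (designMatrix θ n δ)ᵀ * weightMatrix K θ n δ * designMatrix θ n δ =
      !![∑ i, weightMatrix K θ n δ i i, ∑ i, weightMatrix K θ n δ i i * regDist θ n δ i ^ 2;
        ∑ i, weightMatrix K θ n δ i i * regDist θ n δ i ^ 2,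
        ∑ i, weightMatrix K θ n δ i i * regDist θ n δ i ^ 4] := by
  unfold weightMatrix
  ext a b
  rw [Matrix.mul_apply]
  simp only [Matrix.mul_diagonal, Matrix.transpose_apply, designMatrix, Matrix.of_apply,
    Matrix.diagonal_apply_eq]
  fin_cases a <;> fin_cases b <;> simp <;> refine Finset.sum_congr rfl fun i _ => ?_ <;> ring

/-- Cramer's rule for the two normal equations; the scale `2πδ` of the distances and the factor
`(2πδ)⁻¹` of the weights cancel. -/
lemma wlsCoeff_eq (K : ℝ → ℝ) (θ : ℝ) (n : ℕ) (δ : ℝ) (hδ : 0 < δ) (i : Fin (numFreq n δ)) :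
    let u : Fin (numFreq n δ) → ℝ := fun i => regDist θ n δ i / (2 * Real.pi * δ)
    wlsCoeff K θ n δ i = K (u i) * ((∑ l, K (u l) * u l ^ 4) - (∑ l, K (u l) * u l ^ 2) * u i ^ 2) /
      ((∑ l, K (u l)) * (∑ l, K (u l) * u l ^ 4) - (∑ l, K (u l) * u l ^ 2) ^ 2) := by
  intro u
  have hπ := Real.pi_pos
  set ρ : ℝ := 2 * Real.pi * δ with hρ
  have hρ0 : 0 < ρ := by positivity
  have hd : ∀ l, regDist θ n δ l = ρ * u l := fun l => by
    simp only [u]; rw [hρ]; field_simp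
  have hw : ∀ l, weightMatrix K θ n δ l l = ρ⁻¹ * K (u l) := fun l => by
    simp only [weightMatrix, Matrix.diagonal_apply_eq]
    rfl
  have s0 : ∑ l, weightMatrix K θ n δ l l = ρ⁻¹ * ∑ l, K (u l) := by
    simp only [hw, Finset.mul_sum]
  have s2 : ∑ l, weightMatrix K θ n δ l l * regDist θ n δ l ^ 2 =
      ρ * ∑ l, K (u l) * u l ^ 2 := by
    simp only [hw, hd, Finset.mul_sum]
    exact Finset.sum_congr rfl fun l _ => by field_simp
  have s4 : ∑ l, weightMatrix K θ n δ l l * regDist θ n δ l ^ 4 =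
      ρ ^ 3 * ∑ l, K (u l) * u l ^ 4 := by
    simp only [hw, hd, Finset.mul_sum]
    exact Finset.sum_congr rfl fun l _ => by field_simp
  set S0 := ∑ l, K (u l)
  set S2 := ∑ l, K (u l) * u l ^ 2
  set S4 := ∑ l, K (u l) * u l ^ 4
  have hB0 : ((designMatrix θ n δ)ᵀ * weightMatrix K θ n δ) 0 i = ρ⁻¹ * K (u i) := by
    rw [← hw i]
    simp [weightMatrix, Matrix.mul_diagonal, designMatrix]
  have hB1 : ((designMatrix θ n δ)ᵀ * weightMatrix K θ n δ) 1 i =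
      ρ⁻¹ * K (u i) * (ρ * u i) ^ 2 := by
    rw [← hw i, ← hd i]
    simp [weightMatrix, Matrix.mul_diagonal, designMatrix]
    ring
  rw [wlsCoeff, gram_apply, s0, s2, s4, Matrix.mul_apply, Fin.sum_univ_two, hB0, hB1,
    Matrix.inv_def, Matrix.adjugate_fin_two_of, Matrix.det_fin_two_of, Ring.inverse_eq_inv']
  simp only [Matrix.smul_apply, Matrix.of_apply, Matrix.cons_val', Matrix.cons_val_zero,
    Matrix.cons_val_one, smul_eq_mul]
  have hdet : ρ⁻¹ * S0 * (ρ ^ 3 * S4) - ρ * S2 * (ρ * S2) = ρ ^ 2 * (S0 * S4 - S2 ^ 2) := by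
    field_simp
  rw [hdet, mul_inv, div_eq_mul_inv]
  field_simp
  ring

/-- The intercept of the weighted regression reproduces even quadratics and has coefficients of
order `1 / (δ n)`. -/
lemma IsKernel.exists_wlsCoeff_bound {K : ℝ → ℝ} (hK : IsKernel K) {θ : ℝ}
    (hθ : θ = 0 ∨ θ = Real.pi ∨ θ = -Real.pi) :
    ∃ C L : ℝ, 0 < C ∧ 0 < L ∧ ∀ (n : ℕ) (δ : ℝ), 0 < δ → δ < 1 / 2 → L ≤ δ * n →
      ∑ i, wlsCoeff K θ n δ i = 1 ∧
      ∑ i, wlsCoeff K θ n δ i * regDist θ n δ i ^ 2 = 0 ∧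
      ∀ i, |wlsCoeff K θ n δ i| ≤ C / (δ * n) := by
  obtain ⟨c, L, hc, hL, hlow⟩ := hK.exists_gram_lower_bound
  obtain ⟨B₀, hB₀⟩ := hK.bounded
  set B := max B₀ 1
  have hB : ∀ x ∈ Set.Icc (0 : ℝ) 1, K x ≤ B := fun x hx => (hB₀ x hx).trans (le_max_left _ _)
  have hB1 : 0 < B := zero_lt_one.trans_le (le_max_right _ _)
  refine ⟨B * (2 * B) / c, L, by positivity, hL, fun n δ hδ0 hδ hLn => ?_⟩
  have hπ := Real.pi_pos
  have hNpos : 0 < δ * n := hL.trans_le hLn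
  have hn' : (0 : ℝ) < n := by
    by_contra hneg
    nlinarith
  have hn : 0 < n := by exact_mod_cast hn'
  obtain ⟨e, σ, he0, he1, hσ, hu⟩ := exists_regDist_grid hθ hδ0 hn
  have hu01 := regDist_div_mem_Icc hθ hδ0 hn
  have hD := hlow _ (δ * n) e hLn rfl he0 he1
    (fun i => regDist θ n δ i / (2 * Real.pi * δ)) σ hσ.1 hu hu01
  have heq := wlsCoeff_eq K θ n δ hδ0
  set u : Fin (numFreq n δ) → ℝ := fun i => regDist θ n δ i / (2 * Real.pi * δ) with hudef
  have hd : ∀ l, regDist θ n δ l = (2 * Real.pi * δ) * u l := fun l => by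
    simp only [hudef]; field_simp
  simp only at heq hD
  set S0 := ∑ l, K (u l) with hS0
  set S2 := ∑ l, K (u l) * u l ^ 2 with hS2
  set S4 := ∑ l, K (u l) * u l ^ 4 with hS4
  have hDpos : 0 < S0 * S4 - S2 ^ 2 := lt_of_lt_of_le (by positivity) hD
  have hM : ((numFreq n δ : ℕ) : ℝ) ≤ δ * n := Nat.floor_le hNpos.le
  have hKn : ∀ l, 0 ≤ K (u l) := fun l => hK.nonneg _ (hu01 l)
  have hKB : ∀ l, K (u l) ≤ B := fun l => hB _ (hu01 l)
  -- All kernel moments are `O(δ n)`, so the numerator of a coefficient is `O(δ n)` against a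
  -- determinant of order at least `(δ n) ^ 2`.
  have hpow : ∀ p : ℕ, 0 ≤ ∑ l, K (u l) * u l ^ p ∧ ∑ l, K (u l) * u l ^ p ≤ B * (δ * n) := by
    intro p
    refine ⟨Finset.sum_nonneg fun l _ => mul_nonneg (hKn l) (pow_nonneg (hu01 l).1 p), ?_⟩
    calc ∑ l, K (u l) * u l ^ p ≤ ∑ _l : Fin (numFreq n δ), B * 1 :=
          Finset.sum_le_sum fun l _ => mul_le_mul (hKB l) (pow_le_one₀ (hu01 l).1 (hu01 l).2)
            (pow_nonneg (hu01 l).1 p) hB1.le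
      _ = (numFreq n δ : ℕ) * B := by simp
      _ ≤ B * (δ * n) := by nlinarith
  refine ⟨?_, ?_, fun i => ?_⟩
  · simp only [heq, ← Finset.sum_div]
    rw [div_eq_one_iff_eq hDpos.ne']
    have : ∀ i, K (u i) * (S4 - S2 * u i ^ 2) = K (u i) * S4 - S2 * (K (u i) * u i ^ 2) :=
      fun i => by ring
    simp only [this, Finset.sum_sub_distrib, ← Finset.mul_sum, ← Finset.sum_mul]
    rw [← hS0, ← hS2]
    ring
  · have : ∀ i, wlsCoeff K θ n δ i * regDist θ n δ i ^ 2 =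
        (2 * Real.pi * δ) ^ 2 / (S0 * S4 - S2 ^ 2) *
          (S4 * (K (u i) * u i ^ 2) - S2 * (K (u i) * u i ^ 4)) := fun i => by
      rw [heq, hd]; ring
    simp only [this, ← Finset.mul_sum, Finset.sum_sub_distrib]
    rw [← hS2, ← hS4]
    ring
  · rw [heq, abs_div, abs_of_pos hDpos, div_le_div_iff₀ hDpos hNpos, abs_mul, abs_of_nonneg (hKn i)]
    have h2 : |S4 - S2 * u i ^ 2| ≤ 2 * B * (δ * n) := by
      have h4 := hpow 4
      have h2 := hpow 2
      have hui : u i ^ 2 ≤ 1 := pow_le_one₀ (hu01 i).1 (hu01 i).2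
      have hui0 : 0 ≤ u i ^ 2 := sq_nonneg _
      have h3 : S2 * u i ^ 2 ≤ B * (δ * n) :=
        (mul_le_of_le_one_right h2.1 hui).trans h2.2
      have h3' : 0 ≤ S2 * u i ^ 2 := mul_nonneg h2.1 hui0
      have hpos : 0 ≤ B * (δ * n) := by positivity
      rw [abs_le]
      constructor <;> linarith [h4.1, h4.2]
    calc K (u i) * |S4 - S2 * u i ^ 2| * (δ * n) ≤ B * (2 * B * (δ * n)) * (δ * n) := by
          refine mul_le_mul_of_nonneg_right ?_ hNpos.le
          exact mul_le_mul (hKB i) h2 (abs_nonneg _) hB1.le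
      _ = B * (2 * B) / c * (c * (δ * n) ^ 2) := by field_simp
      _ ≤ B * (2 * B) / c * (S0 * S4 - S2 ^ 2) :=
          mul_le_mul_of_nonneg_left hD (by positivity)

/-! ### Second order structure of a stationary Gaussian series -/

section StationarySeries

variable {Ω : Type*} [MeasurableSpace Ω] {P : Measure Ω} {m : ℕ} {X : ℤ → Ω → (Fin m → ℝ)}

lemma isGaussianProcess_coord (hgauss : IsGaussianProcess X P) :
    IsGaussianProcess (fun (i : ℤ × Fin m) ω => X i.1 ω i.2) P :=
  (hgauss.comp_right Prod.fst).comp_left (fun i : ℤ × Fin m => ContinuousLinearMap.proj i.2)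

lemma StrictlyStationary.integral_eq (hstat : StrictlyStationary P X) (hX : ∀ t, Measurable (X t))
    (t : ℤ) (j : Fin m) : ∫ ω, X t ω j ∂P = ∫ ω, X 0 ω j ∂P := by
  have hm : ∀ h : ℤ, Measurable fun ω (s : ℤ) => X (s + h) ω := fun h =>
    measurable_pi_lambda _ fun s => hX (s + h)
  have hm0 : Measurable fun ω (s : ℤ) => X s ω := measurable_pi_lambda _ fun s => hX s
  have he : Measurable fun x : ℤ → Fin m → ℝ => x 0 j := by fun_prop
  have h1 := integral_map (μ := P) (hm t).aemeasurable (f := fun x : ℤ → Fin m → ℝ => x 0 j)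
    he.aestronglyMeasurable
  have h2 := integral_map (μ := P) hm0.aemeasurable (f := fun x : ℤ → Fin m → ℝ => x 0 j)
    he.aestronglyMeasurable
  rw [hstat t, h2] at h1
  simpa using h1.symm

lemma StrictlyStationary.covariance_eq (hstat : StrictlyStationary P X)
    (hX : ∀ t, Measurable (X t)) (t u : ℤ) (j k : Fin m) :
    cov[fun ω => X t ω j, fun ω => X u ω k; P] = autocov P X j k (t - u) := by
  have hm : ∀ h : ℤ, Measurable fun ω (s : ℤ) => X (s + h) ω := fun h =>
    measurable_pi_lambda _ fun s => hX (s + h)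
  have hm0 : Measurable fun ω (s : ℤ) => X s ω := measurable_pi_lambda _ fun s => hX s
  have he : ∀ (s : ℤ) (i : Fin m), Measurable fun x : ℤ → Fin m → ℝ => x s i := by fun_prop
  have h1 := covariance_map_fun (μ := P) (Z := fun ω (s : ℤ) => X (s + u) ω)
    (X := fun x : ℤ → Fin m → ℝ => x (t - u) j) (Y := fun x : ℤ → Fin m → ℝ => x 0 k)
    (he _ _).aestronglyMeasurable (he _ _).aestronglyMeasurable (hm u).aemeasurable
  have h2 := covariance_map_fun (μ := P) (Z := fun ω (s : ℤ) => X s ω)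
    (X := fun x : ℤ → Fin m → ℝ => x (t - u) j) (Y := fun x : ℤ → Fin m → ℝ => x 0 k)
    (he _ _).aestronglyMeasurable (he _ _).aestronglyMeasurable hm0.aemeasurable
  rw [hstat u, h2] at h1
  simpa [autocov] using h1.symm

/-- Covers every `n` and `δ`, including degenerate regressions, so it works directly with the sample
mean: deviations are in `L⁴`, their products in `L²`. -/
lemma memLp_localQuad (hgauss : IsGaussianProcess X P) (K : ℝ → ℝ) (θ : ℝ) (n : ℕ) (δ : ℝ)
    (j k : Fin m) : MemLp (fun ω => localQuad K θ n δ (fun t => X t ω) j k) 2 P := by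
  have hW := isGaussianProcess_coord hgauss
  have h4 : ∀ t j, MemLp (fun ω => X t ω j) 4 P := fun t j =>
    (hW.hasGaussianLaw_eval (t, j)).memLp (by simp)
  have hm : ∀ j, MemLp (fun ω => sampleMean n (fun t => X t ω) j) 4 P := fun j =>
    (memLp_finsetSum _ fun t _ => h4 t j).const_mul _
  have hd : ∀ t j, MemLp (fun ω => X t ω j - sampleMean n (fun t => X t ω) j) 4 P :=
    fun t j => (h4 t j).sub (hm j)
  have hp : ∀ p q, MemLp (fun ω => (X p ω j - sampleMean n (fun t => X t ω) j) *
      (X q ω k - sampleMean n (fun t => X t ω) k)) 2 P := fun p q => (hd q k).mul (hd p j)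
  simp only [localQuad_eq_sum, re_periodogram]
  exact memLp_finsetSum _ fun i _ => ((memLp_finsetSum _ fun p _ => memLp_finsetSum _ fun q _ =>
    (hp p q).const_mul _).const_mul _).const_mul _

lemma specDensity_eq (w : ℝ) (j k : Fin m) :
    specDensity P X w j k = (2 * (Real.pi : ℂ))⁻¹ * trigSeries (autocov P X j k) w := rfl

lemma contDiff_trigSeries_autocov {p : ℕ} (hA : AssumptionA P X p) (j k : Fin m) :
    ContDiff ℝ p (trigSeries (autocov P X j k)) := by
  have h := (contDiff_const (c := 2 * (Real.pi : ℂ))).mul (hA j k).2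
  have he : trigSeries (autocov P X j k) = fun w => 2 * (Real.pi : ℂ) * specDensity P X w j k := by
    funext w
    have : (Real.pi : ℂ) ≠ 0 := by exact_mod_cast Real.pi_ne_zero
    rw [specDensity_eq]
    field_simp
  rw [he]
  exact h

/-- The spectral density is real at these frequencies, so the complex error reduces to a real one.
-/
lemma norm_sq_estError {θ : ℝ} (hθ : θ = 0 ∨ θ = Real.pi ∨ θ = -Real.pi) (K : ℝ → ℝ) (n : ℕ)
    (δ : ℝ) (j k : Fin m) (ω : Ω) :
    ‖estError P X K θ n δ ω j k‖ ^ 2 = (localQuad K θ n δ (fun t => X t ω) j k -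
      (2 * Real.pi)⁻¹ * (trigSeries (autocov P X j k) θ).re) ^ 2 := by
  have hts : trigSeries (autocov P X j k) θ = ((trigSeries (autocov P X j k) θ).re : ℂ) := by
    apply Complex.ext
    · simp
    · rw [im_trigSeries_eq_zero _ hθ, Complex.ofReal_im]
  have : estError P X K θ n δ ω j k = ((localQuad K θ n δ (fun t => X t ω) j k -
      (2 * Real.pi)⁻¹ * (trigSeries (autocov P X j k) θ).re : ℝ) : ℂ) := by
    unfold estError
    rw [Matrix.sub_apply, Matrix.map_apply, specDensity_eq, hts]
    push_cast
    rfl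
  rw [this, Complex.norm_real, Real.norm_eq_abs, sq_abs]

lemma integrable_norm_sq_estError (hgauss : IsGaussianProcess X P)
    {θ : ℝ} (hθ : θ = 0 ∨ θ = Real.pi ∨ θ = -Real.pi) (K : ℝ → ℝ) (n : ℕ) (δ : ℝ) (j k : Fin m) :
    Integrable (fun ω => ‖estError P X K θ n δ ω j k‖ ^ 2) P := by
  have := hgauss.isProbabilityMeasure
  simp only [norm_sq_estError hθ]
  exact ((memLp_localQuad hgauss K θ n δ j k).sub (memLp_const _)).integrable_sq

/-- At Fourier frequencies the estimator is a quadratic form in the centered series. -/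
lemma localQuad_eq_quadratic (hX : ∀ t, Measurable (X t)) (hstat : StrictlyStationary P X)
    (K : ℝ → ℝ) (θ : ℝ) {n : ℕ} {δ : ℝ} (hδ0 : 0 < δ) (hδ : δ < 1 / 2) (hn : 0 < n)
    (j k : Fin m) (ω : Ω) :
    localQuad K θ n δ (fun t => X t ω) j k =
      ∑ x ∈ Finset.Icc (1 : ℤ) n ×ˢ Finset.Icc (1 : ℤ) n,
        ((2 * Real.pi * n)⁻¹ * ∑ i, wlsCoeff K θ n δ i *
          Real.cos (2 * Real.pi * regIndex θ n δ i / n * ((x.1 : ℝ) - x.2))) *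
        ((X x.1 ω j - ∫ ω', X x.1 ω' j ∂P) * (X x.2 ω k - ∫ ω', X x.2 ω' k ∂P)) := by
  have hdvd : ∀ i, ¬ (n : ℤ) ∣ regIndex θ n δ i := by
    intro i hd
    have h1 := one_le_regIndex θ hδ0 hδ i
    have h2 := two_mul_regIndex_le θ hδ0 hδ i
    have := Int.le_of_dvd (by omega) hd
    omega
  have hper : ∀ i, (periodogram n (fun t => X t ω) (regFreq θ n δ i) j k).re =
      (2 * Real.pi * n)⁻¹ * ∑ p ∈ Finset.Icc (1 : ℤ) n, ∑ q ∈ Finset.Icc (1 : ℤ) n,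
        Real.cos (2 * Real.pi * regIndex θ n δ i / n * ((p : ℝ) - q)) *
          ((X p ω j - ∫ ω', X 0 ω' j ∂P) * (X q ω k - ∫ ω', X 0 ω' k ∂P)) := fun i => by
    rw [regFreq_eq]
    exact re_periodogram_fourier n hn (fun t => X t ω) (regIndex θ n δ i) (hdvd i) j k
      (∫ ω', X 0 ω' j ∂P) (∫ ω', X 0 ω' k ∂P)
  simp only [localQuad_eq_sum, hper, hstat.integral_eq hX]
  rw [Finset.sum_product]
  simp only [Finset.mul_sum, Finset.sum_mul]
  rw [Finset.sum_comm]
  refine Finset.sum_congr rfl fun p _ => ?_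
  rw [Finset.sum_comm]
  refine Finset.sum_congr rfl fun q _ => Finset.sum_congr rfl fun i _ => ?_
  ring

lemma sum_abs_sub_le_tsum {c : ℤ → ℝ} (hc : Summable c) (s : Finset ℤ) (p : ℤ) :
    ∑ q ∈ s, |c (p - q)| ≤ ∑' h, |c h| := by
  have hs : Summable fun q => |c (p - q)| := (Equiv.subLeft p).summable_iff.2 hc.abs
  calc _ ≤ ∑' q, |c (p - q)| := hs.sum_le_tsum _ fun _ _ => abs_nonneg _
    _ = _ := (Equiv.subLeft p).tsum_eq fun h => |c h|

lemma sum_abs_sub_le_tsum' {c : ℤ → ℝ} (hc : Summable c) (s : Finset ℤ) (q : ℤ) :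
    ∑ p ∈ s, |c (p - q)| ≤ ∑' h, |c h| := by
  have hs : Summable fun p => |c (p - q)| := (Equiv.subRight q).summable_iff.2 hc.abs
  calc _ ≤ ∑' p, |c (p - q)| := hs.sum_le_tsum _ fun _ _ => abs_nonneg _
    _ = _ := (Equiv.subRight q).tsum_eq fun h => |c h|

/-- Bound for the variance of a quadratic form in a stationary Gaussian series with summable
autocovariances. -/
lemma sum_sum_cov_le (hA : ∀ j k, Summable (autocov P X j k)) (hX : ∀ t, Measurable (X t))
    (hstat : StrictlyStationary P X) (s : Finset ℤ) (A : ℤ × ℤ → ℝ) (j k : Fin m) :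
    ∑ x ∈ s ×ˢ s, ∑ y ∈ s ×ˢ s, A x * A y *
      (cov[fun ω => X x.1 ω j, fun ω => X y.1 ω j; P] *
          cov[fun ω => X x.2 ω k, fun ω => X y.2 ω k; P] +
        cov[fun ω => X x.1 ω j, fun ω => X y.2 ω k; P] *
          cov[fun ω => X x.2 ω k, fun ω => X y.1 ω j; P]) ≤
      ((∑' h, |autocov P X j j h|) * (∑' h, |autocov P X k k h|) +
        (∑' h, |autocov P X j k h|) * (∑' h, |autocov P X k j h|)) * ∑ x ∈ s ×ˢ s, A x ^ 2 := by
  simp only [hstat.covariance_eq hX]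
  have hR : ∀ j k, 0 ≤ ∑' h, |autocov P X j k h| := fun j k => tsum_nonneg fun _ => abs_nonneg _
  have hprod : ∀ (F G : ℤ → ℝ) (a b : ℝ), (∀ p, 0 ≤ F p) → (∀ p, 0 ≤ G p) → 0 ≤ a →
      ∑ p ∈ s, F p ≤ a → ∑ q ∈ s, G q ≤ b → ∑ x ∈ s ×ˢ s, F x.1 * G x.2 ≤ a * b := by
    intro F G a b hF hG ha h1 h2
    rw [Finset.sum_product, ← Finset.sum_mul_sum]
    exact mul_le_mul h1 h2 (Finset.sum_nonneg fun q _ => hG q) ha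
  -- The second Isserlis pairing matches the first time of one pair with the second time of the
  -- other, so the coordinates enter crosswise.
  have hprod' : ∀ (F G : ℤ → ℝ) (a b : ℝ), (∀ p, 0 ≤ F p) → (∀ p, 0 ≤ G p) → 0 ≤ a →
      ∑ p ∈ s, F p ≤ a → ∑ q ∈ s, G q ≤ b → ∑ x ∈ s ×ˢ s, F x.2 * G x.1 ≤ a * b := by
    intro F G a b hF hG ha h1 h2
    rw [Finset.sum_product_right, ← Finset.sum_mul_sum]
    exact mul_le_mul h1 h2 (Finset.sum_nonneg fun q _ => hG q) ha
  have h1 := sum_sum_mul_le_of_schur (s ×ˢ s) A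
    (fun x y => |autocov P X j j (x.1 - y.1)| * |autocov P X k k (x.2 - y.2)|)
    ((∑' h, |autocov P X j j h|) * (∑' h, |autocov P X k k h|)) (fun x y => by positivity)
    (fun x _ => hprod (fun p => |autocov P X j j (x.1 - p)|) (fun q => |autocov P X k k (x.2 - q)|)
      _ _ (fun _ => abs_nonneg _) (fun _ => abs_nonneg _) (hR j j)
      (sum_abs_sub_le_tsum (hA j j) s x.1) (sum_abs_sub_le_tsum (hA k k) s x.2))
    (fun y _ => hprod (fun p => |autocov P X j j (p - y.1)|) (fun q => |autocov P X k k (q - y.2)|)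
      _ _ (fun _ => abs_nonneg _) (fun _ => abs_nonneg _) (hR j j)
      (sum_abs_sub_le_tsum' (hA j j) s y.1) (sum_abs_sub_le_tsum' (hA k k) s y.2))
  have h2 := sum_sum_mul_le_of_schur (s ×ˢ s) A
    (fun x y => |autocov P X j k (x.1 - y.2)| * |autocov P X k j (x.2 - y.1)|)
    ((∑' h, |autocov P X j k h|) * (∑' h, |autocov P X k j h|)) (fun x y => by positivity)
    (fun x _ => hprod' (fun p => |autocov P X j k (x.1 - p)|) (fun q => |autocov P X k j (x.2 - q)|)
      _ _ (fun _ => abs_nonneg _) (fun _ => abs_nonneg _) (hR j k)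
      (sum_abs_sub_le_tsum (hA j k) s x.1) (sum_abs_sub_le_tsum (hA k j) s x.2))
    (fun y _ => hprod (fun p => |autocov P X j k (p - y.2)|) (fun q => |autocov P X k j (q - y.1)|)
      _ _ (fun _ => abs_nonneg _) (fun _ => abs_nonneg _) (hR j k)
      (sum_abs_sub_le_tsum' (hA j k) s y.2) (sum_abs_sub_le_tsum' (hA k j) s y.1))
  rw [add_mul]
  refine le_trans ?_ (add_le_add h1 h2)
  rw [← Finset.sum_add_distrib]
  refine Finset.sum_le_sum fun x _ => ?_
  rw [← Finset.sum_add_distrib]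
  refine Finset.sum_le_sum fun y _ => ?_
  simp only [← abs_mul]
  rw [mul_add]
  exact add_le_add (le_abs_self _) (le_abs_self _)

end StationarySeries

/-! ### Bias, variance and mean squared error. -/

section MSE

variable {Ω : Type*} [MeasurableSpace Ω] {P : Measure Ω} {m : ℕ} {X : ℤ → Ω → (Fin m → ℝ)}

lemma sum_abs_wlsCoeff_le {K : ℝ → ℝ} {θ : ℝ} {n : ℕ} {δ C : ℝ} (hN : 0 < δ * n)
    (h : ∀ i, |wlsCoeff K θ n δ i| ≤ C / (δ * n)) (hC : 0 < C) :
    ∑ i, |wlsCoeff K θ n δ i| ≤ C := by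
  have hM : ((numFreq n δ : ℕ) : ℝ) ≤ δ * n := Nat.floor_le hN.le
  calc ∑ i, |wlsCoeff K θ n δ i| ≤ ∑ _i : Fin (numFreq n δ), C / (δ * n) :=
        Finset.sum_le_sum fun i _ => h i
    _ = (numFreq n δ : ℕ) * (C / (δ * n)) := by simp
    _ ≤ (δ * n) * (C / (δ * n)) := by gcongr
    _ = C := by rw [← mul_div_assoc, mul_comm, mul_div_assoc, div_self hN.ne', mul_one]

lemma sum_sq_wlsCoeff_le {K : ℝ → ℝ} {θ : ℝ} {n : ℕ} {δ C : ℝ} (hN : 0 < δ * n)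
    (h : ∀ i, |wlsCoeff K θ n δ i| ≤ C / (δ * n)) (hC : 0 < C) :
    ∑ i, wlsCoeff K θ n δ i ^ 2 ≤ C ^ 2 / (δ * n) := by
  calc ∑ i, wlsCoeff K θ n δ i ^ 2 ≤ ∑ i, C / (δ * n) * |wlsCoeff K θ n δ i| := by
        refine Finset.sum_le_sum fun i _ => ?_
        rw [← sq_abs, sq]
        exact mul_le_mul_of_nonneg_right (h i) (abs_nonneg _)
    _ = C / (δ * n) * ∑ i, |wlsCoeff K θ n δ i| := by rw [Finset.mul_sum]
    _ ≤ C / (δ * n) * C := by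
        have := sum_abs_wlsCoeff_le hN h hC
        gcongr
    _ = C ^ 2 / (δ * n) := by ring

/-- The `n ^ 2` from orthogonality of the cosines cancels the `n⁻¹ ^ 2` of the periodogram
normalization, so the norm of the form does not grow with `n`. -/
lemma sum_sq_quadratic_coeff_le (K : ℝ → ℝ) (θ : ℝ) {n : ℕ} {δ : ℝ} (hδ0 : 0 < δ)
    (hδ : δ < 1 / 2) (hn : 0 < n) :
    ∑ x ∈ Finset.Icc (1 : ℤ) n ×ˢ Finset.Icc (1 : ℤ) n,
      ((2 * Real.pi * n)⁻¹ * ∑ i, wlsCoeff K θ n δ i *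
        Real.cos (2 * Real.pi * regIndex θ n δ i / n * ((x.1 : ℝ) - x.2))) ^ 2 ≤
      ∑ i, wlsCoeff K θ n δ i ^ 2 := by
  have hn' : (0 : ℝ) < n := by exact_mod_cast hn
  have h := sum_sum_sq_cos_le n hn (regIndex θ n δ) (regIndex_injective θ n δ)
    (one_le_regIndex θ hδ0 hδ) (two_mul_regIndex_le θ hδ0 hδ) (wlsCoeff K θ n δ)
  simp only [mul_pow, ← Finset.mul_sum]
  rw [Finset.sum_product]
  have hS : 0 ≤ ∑ i, wlsCoeff K θ n δ i ^ 2 := Finset.sum_nonneg fun i _ => sq_nonneg _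
  calc _ ≤ ((2 * Real.pi * n)⁻¹) ^ 2 * ((n : ℝ) ^ 2 * ∑ i, wlsCoeff K θ n δ i ^ 2) :=
        mul_le_mul_of_nonneg_left h (by positivity)
    _ = ((2 * Real.pi)⁻¹) ^ 2 * ∑ i, wlsCoeff K θ n δ i ^ 2 := by
        have := Real.pi_ne_zero
        field_simp
    _ ≤ 1 * ∑ i, wlsCoeff K θ n δ i ^ 2 := by
        refine mul_le_mul_of_nonneg_right ?_ hS
        refine pow_le_one₀ (by positivity) (inv_le_one_of_one_le₀ ?_)
        linarith [Real.pi_gt_three]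
    _ = _ := one_mul _

/-- The bias of the estimator, given an expansion of the spectral density. -/
lemma abs_bias_le {c : ℤ → ℝ} (hc : Summable c) (hs : Summable fun h : ℤ => |(h : ℝ)| * |c h|)
    {K : ℝ → ℝ} {θ : ℝ} (hθ : θ = 0 ∨ θ = Real.pi ∨ θ = -Real.pi) {n : ℕ} {δ C A D : ℝ}
    (hδ0 : 0 < δ) (hδ : δ < 1 / 2) (hn : 0 < n) (hC : 0 < C) (hD : 0 ≤ D)
    (hexp : ∀ w : ℝ, |(|θ| - w)| ≤ Real.pi →
      |(trigSeries c w).re - ((trigSeries c θ).re + A * |(|θ| - w)| ^ 2)| ≤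
        D * |(|θ| - w)| ^ 4)
    (h0 : ∑ i, wlsCoeff K θ n δ i = 1)
    (h2 : ∑ i, wlsCoeff K θ n δ i * regDist θ n δ i ^ 2 = 0)
    (hb : ∀ i, |wlsCoeff K θ n δ i| ≤ C / (δ * n)) :
    |∑ x ∈ Finset.Icc (1 : ℤ) n ×ˢ Finset.Icc (1 : ℤ) n,
        ((2 * Real.pi * n)⁻¹ * ∑ i, wlsCoeff K θ n δ i *
          Real.cos (2 * Real.pi * regIndex θ n δ i / n * ((x.1 : ℝ) - x.2))) * c (x.1 - x.2) -
      (2 * Real.pi)⁻¹ * (trigSeries c θ).re| ≤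
    C * ((∑' h : ℤ, |(h : ℝ)| * |c h|) / n + D * (2 * Real.pi * δ) ^ 4) := by
  have hπ := Real.pi_pos
  have hn' : (0 : ℝ) < n := by exact_mod_cast hn
  set T := ∑' h : ℤ, |(h : ℝ)| * |c h| with hT
  have hT0 : 0 ≤ T := tsum_nonneg fun h => by positivity
  have e1 : ∑ x ∈ Finset.Icc (1 : ℤ) n ×ˢ Finset.Icc (1 : ℤ) n,
        ((2 * Real.pi * n)⁻¹ * ∑ i, wlsCoeff K θ n δ i *
          Real.cos (2 * Real.pi * regIndex θ n δ i / n * ((x.1 : ℝ) - x.2))) * c (x.1 - x.2) =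
      (2 * Real.pi)⁻¹ * ∑ i, wlsCoeff K θ n δ i * ((n : ℝ)⁻¹ *
        ∑ p ∈ Finset.Icc (1 : ℤ) n, ∑ q ∈ Finset.Icc (1 : ℤ) n,
          Real.cos (regFreq θ n δ i * ((p : ℝ) - q)) * c (p - q)) := by
    rw [Finset.sum_product]
    simp only [Finset.mul_sum, Finset.sum_mul, regFreq_eq]
    symm
    rw [Finset.sum_comm]
    refine Finset.sum_congr rfl fun p _ => ?_
    rw [Finset.sum_comm]
    refine Finset.sum_congr rfl fun q _ => Finset.sum_congr rfl fun i _ => ?_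
    rw [mul_inv (2 * Real.pi) (n : ℝ)]
    ring
  -- Exact reproduction of constants and squared distances lets the target be compared with the
  -- quadratic expansion frequency by frequency.
  have e2 : (trigSeries c θ).re =
      ∑ i, wlsCoeff K θ n δ i * ((trigSeries c θ).re + A * regDist θ n δ i ^ 2) := by
    have : ∀ i, wlsCoeff K θ n δ i * ((trigSeries c θ).re + A * regDist θ n δ i ^ 2) =
        wlsCoeff K θ n δ i * (trigSeries c θ).re +
          A * (wlsCoeff K θ n δ i * regDist θ n δ i ^ 2) := fun i => by ring
    simp only [this, Finset.sum_add_distrib, ← Finset.mul_sum, ← Finset.sum_mul, h0, h2]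
    ring
  rw [e1]
  conv_lhs => rw [e2]
  rw [← mul_sub, ← Finset.sum_sub_distrib, abs_mul, abs_of_pos (by positivity)]
  have hE : 0 ≤ T / n + D * (2 * Real.pi * δ) ^ 4 := by positivity
  have hterm : ∀ i, |wlsCoeff K θ n δ i * ((n : ℝ)⁻¹ *
        ∑ p ∈ Finset.Icc (1 : ℤ) n, ∑ q ∈ Finset.Icc (1 : ℤ) n,
          Real.cos (regFreq θ n δ i * ((p : ℝ) - q)) * c (p - q)) -
      wlsCoeff K θ n δ i * ((trigSeries c θ).re + A * regDist θ n δ i ^ 2)| ≤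
      |wlsCoeff K θ n δ i| * (T / n + D * (2 * Real.pi * δ) ^ 4) := by
    intro i
    rw [← mul_sub, abs_mul]
    refine mul_le_mul_of_nonneg_left ?_ (abs_nonneg _)
    have hd : regDist θ n δ i ≤ 2 * Real.pi * δ := regDist_le hθ hδ0 hn i
    have hd0 : 0 ≤ regDist θ n δ i := abs_nonneg _
    have t1 := abs_cesaro_sub_le hc hs n hn (regFreq θ n δ i)
    have t2 := hexp (regFreq θ n δ i) (hd.trans (by nlinarith))
    have t3 : D * regDist θ n δ i ^ 4 ≤ D * (2 * Real.pi * δ) ^ 4 := by gcongr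
    refine (abs_sub_le _ (trigSeries c (regFreq θ n δ i)).re _).trans (add_le_add t1 ?_)
    exact t2.trans t3
  calc _ ≤ 1 * |∑ i, (wlsCoeff K θ n δ i * ((n : ℝ)⁻¹ *
        ∑ p ∈ Finset.Icc (1 : ℤ) n, ∑ q ∈ Finset.Icc (1 : ℤ) n,
          Real.cos (regFreq θ n δ i * ((p : ℝ) - q)) * c (p - q)) -
      wlsCoeff K θ n δ i * ((trigSeries c θ).re + A * regDist θ n δ i ^ 2))| := by
        refine mul_le_mul_of_nonneg_right (inv_le_one_of_one_le₀ ?_) (abs_nonneg _)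
        linarith [Real.pi_gt_three]
    _ ≤ ∑ i, |wlsCoeff K θ n δ i| * (T / n + D * (2 * Real.pi * δ) ^ 4) := by
        rw [one_mul]
        exact (Finset.abs_sum_le_sum_abs _ _).trans (Finset.sum_le_sum fun i _ => hterm i)
    _ ≤ C * (T / n + D * (2 * Real.pi * δ) ^ 4) := by
        rw [← Finset.sum_mul]
        exact mul_le_mul_of_nonneg_right
          (sum_abs_wlsCoeff_le (by positivity) hb hC) hE

/-- Bias-variance bound for the estimator, seen as a quadratic form in the series. -/
lemma mse_le_bias_sq_add (hX : ∀ t, Measurable (X t)) (hstat : StrictlyStationary P X)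
    (hgauss : IsGaussianProcess X P) (hsum : ∀ j k, Summable (autocov P X j k)) (K : ℝ → ℝ)
    {θ : ℝ} (hθ : θ = 0 ∨ θ = Real.pi ∨ θ = -Real.pi) {n : ℕ} {δ : ℝ} (hδ0 : 0 < δ)
    (hδ : δ < 1 / 2) (hn : 0 < n) (j k : Fin m) (a : ℤ × ℤ → ℝ)
    (ha : a = fun x => (2 * Real.pi * n)⁻¹ * ∑ i, wlsCoeff K θ n δ i *
      Real.cos (2 * Real.pi * regIndex θ n δ i / n * ((x.1 : ℝ) - x.2))) :
    mse P X K θ n δ j k ≤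
      (∑ x ∈ Finset.Icc (1 : ℤ) n ×ˢ Finset.Icc (1 : ℤ) n, a x * autocov P X j k (x.1 - x.2) -
        (2 * Real.pi)⁻¹ * (trigSeries (autocov P X j k) θ).re) ^ 2 +
      ((∑' h, |autocov P X j j h|) * (∑' h, |autocov P X k k h|) +
        (∑' h, |autocov P X j k h|) * (∑' h, |autocov P X k j h|)) *
        ∑ x ∈ Finset.Icc (1 : ℤ) n ×ˢ Finset.Icc (1 : ℤ) n, a x ^ 2 := by
  have := hgauss.isProbabilityMeasure
  have hW := isGaussianProcess_coord hgauss
  set f0 := (2 * Real.pi)⁻¹ * (trigSeries (autocov P X j k) θ).re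
  set S := Finset.Icc (1 : ℤ) n ×ˢ Finset.Icc (1 : ℤ) n
  obtain ⟨Q, hQ⟩ : ∃ Q : Ω → ℝ, Q = fun ω => ∑ x ∈ S, a x *
    ((X x.1 ω j - ∫ ω', X x.1 ω' j ∂P) * (X x.2 ω k - ∫ ω', X x.2 ω' k ∂P)) := ⟨_, rfl⟩
  have hmse : mse P X K θ n δ j k = ∫ ω, (Q ω - f0) ^ 2 ∂P := by
    unfold mse
    refine integral_congr_ae (Eventually.of_forall fun ω => ?_)
    simp only [norm_sq_estError hθ, localQuad_eq_quadratic hX hstat K θ hδ0 hδ hn, hQ, ha]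
    rfl
  clear ha
  have hQ2 : MemLp Q 2 P := by
    rw [hQ]
    exact memLp_quadratic hW S a (fun x => (x.1, j)) (fun x => (x.2, k))
  have hcv : ∑ x ∈ S, a x * cov[fun ω => X x.1 ω j, fun ω => X x.2 ω k; P] =
      ∑ x ∈ S, a x * autocov P X j k (x.1 - x.2) := by
    simp only [hstat.covariance_eq hX]
  have hEQ : ∫ ω, Q ω ∂P = ∑ x ∈ S, a x * autocov P X j k (x.1 - x.2) := by
    rw [← hcv, hQ]
    exact integral_quadratic hW S a (fun x => (x.1, j)) (fun x => (x.2, k))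
  have hEQ2 : ∫ ω, Q ω ^ 2 ∂P ≤ (∑ x ∈ S, a x * autocov P X j k (x.1 - x.2)) ^ 2 +
      ((∑' h, |autocov P X j j h|) * (∑' h, |autocov P X k k h|) +
        (∑' h, |autocov P X j k h|) * (∑' h, |autocov P X k j h|)) * ∑ x ∈ S, a x ^ 2 := by
    have h := integral_quadratic_sq hW S a (fun x => (x.1, j)) (fun x => (x.2, k))
    rw [← hcv, hQ]
    refine h.le.trans ?_
    gcongr
    exact sum_sum_cov_le hsum hX hstat (Finset.Icc (1 : ℤ) n) a j k
  have hQi : Integrable Q P := hQ2.integrable (by norm_num)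
  -- With the bound on the second moment, this completes to the squared bias plus the variance
  -- bound.
  have hexpand : ∫ ω, (Q ω - f0) ^ 2 ∂P =
      ∫ ω, Q ω ^ 2 ∂P - 2 * f0 * ∫ ω, Q ω ∂P + f0 ^ 2 := by
    have i1 : Integrable (fun ω => Q ω ^ 2 - 2 * f0 * Q ω) P :=
      hQ2.integrable_sq.sub (hQi.const_mul _)
    have e : ∀ ω, (Q ω - f0) ^ 2 = Q ω ^ 2 - 2 * f0 * Q ω + f0 ^ 2 := fun ω => by ring
    simp only [e]
    rw [integral_add i1 (integrable_const _),
      integral_sub hQ2.integrable_sq (hQi.const_mul _), integral_const_mul, integral_const]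
    simp
  rw [hmse, hexpand, hEQ]
  linarith [hEQ2]

/-- Squaring the bias gives terms of order `δ ^ 8` and `n⁻¹ ^ 2`; the latter is absorbed into the
variance order `δ⁻¹ n⁻¹`. -/
theorem exists_mse_le (hX : ∀ t, Measurable (X t)) (hstat : StrictlyStationary P X)
    (hgauss : IsGaussianProcess X P) (hA : AssumptionA P X 4) {K : ℝ → ℝ} (hK : IsKernel K)
    {θ : ℝ} (hθ : θ = 0 ∨ θ = Real.pi ∨ θ = -Real.pi) (j k : Fin m) :
    ∃ C L : ℝ, 0 ≤ C ∧ ∀ (n : ℕ) (δ : ℝ), 0 < δ → δ < 1 / 2 → L ≤ δ * n →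
      mse P X K θ n δ j k ≤ C * δ ^ 8 + C * (δ⁻¹ * (n : ℝ)⁻¹) := by
  have hπ := Real.pi_pos
  obtain ⟨C, L, hC, hL, hcoef⟩ := hK.exists_wlsCoeff_bound hθ
  have hsm : ContDiff ℝ 4 (trigSeries (autocov P X j k)) := contDiff_trigSeries_autocov hA j k
  have hsum : ∀ j k, Summable (autocov P X j k) := fun j k => (hA j k).1
  have hlag := summable_abs_mul_abs (hsum j k) (hsm.of_le (by norm_num))
  obtain ⟨A, D, hD, hexp⟩ := exists_trigSeries_expansion (autocov P X j k) hsm hθ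
  have hT0 : 0 ≤ ∑' h : ℤ, |(h : ℝ)| * |autocov P X j k h| := tsum_nonneg fun h => by positivity
  have hR0 : 0 ≤ (∑' h, |autocov P X j j h|) * (∑' h, |autocov P X k k h|) +
        (∑' h, |autocov P X j k h|) * (∑' h, |autocov P X k j h|) := by
    have : ∀ j k, 0 ≤ ∑' h, |autocov P X j k h| := fun j k => tsum_nonneg fun _ => abs_nonneg _
    exact add_nonneg (mul_nonneg (this _ _) (this _ _)) (mul_nonneg (this _ _) (this _ _))
  have hmain := fun (n : ℕ) (δ : ℝ) (hδ0 : 0 < δ) (hδ : δ < 1 / 2) (hn : 0 < n) =>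
    mse_le_bias_sq_add hX hstat hgauss hsum K hθ hδ0 hδ hn j k _ rfl
  have hbias := fun (n : ℕ) (δ : ℝ) (hδ0 : 0 < δ) (hδ : δ < 1 / 2) (hn : 0 < n) =>
    abs_bias_le (hsum j k) hlag (K := K) hθ hδ0 hδ hn hC hD hexp
  generalize (∑' h : ℤ, |(h : ℝ)| * |autocov P X j k h|) = T at hT0 hbias
  generalize (∑' h, |autocov P X j j h|) * (∑' h, |autocov P X k k h|) +
        (∑' h, |autocov P X j k h|) * (∑' h, |autocov P X k j h|) = R at hR0 hmain
  -- The factor two comes from `(x + y) ^ 2 ≤ 2 x ^ 2 + 2 y ^ 2`, applied to the two parts of the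
  -- bias.
  set C1 := 2 * C ^ 2 * D ^ 2 * (2 * Real.pi) ^ 8 with hC1
  have hC10 : 0 ≤ C1 := by positivity
  have hC20 : 0 ≤ 2 * C ^ 2 * T ^ 2 + R * C ^ 2 := by positivity
  refine ⟨C1 + (2 * C ^ 2 * T ^ 2 + R * C ^ 2), L, by positivity, fun n δ hδ0 hδ hLn => ?_⟩
  have hN : 0 < δ * n := hL.trans_le hLn
  have hn' : (0 : ℝ) < n := by
    by_contra hneg
    nlinarith
  have hn : 0 < n := by exact_mod_cast hn'
  have hn1 : (1 : ℝ) ≤ n := by exact_mod_cast hn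
  obtain ⟨h0, h2, hb⟩ := hcoef n δ hδ0 hδ hLn
  have hb' := hbias n δ hδ0 hδ hn h0 h2 hb
  have hm := hmain n δ hδ0 hδ hn
  have hvar := mul_le_mul_of_nonneg_left
    ((sum_sq_quadratic_coeff_le K θ hδ0 hδ hn).trans (sum_sq_wlsCoeff_le hN hb hC)) hR0
  have hrate : 0 ≤ δ⁻¹ * (n : ℝ)⁻¹ := by positivity
  have hδ8 : 0 ≤ δ ^ 8 := by positivity
  have hsq : (C * (T / n + D * (2 * Real.pi * δ) ^ 4)) ^ 2 ≤
      2 * C ^ 2 * T ^ 2 * (δ⁻¹ * (n : ℝ)⁻¹) + C1 * δ ^ 8 := by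
    have hinv : ((n : ℝ)⁻¹) ^ 2 ≤ δ⁻¹ * (n : ℝ)⁻¹ := by
      rw [sq]
      refine mul_le_mul_of_nonneg_right ?_ (by positivity)
      exact (inv_le_one_of_one_le₀ hn1).trans ((one_le_inv₀ hδ0).2 (by linarith))
    calc (C * (T / n + D * (2 * Real.pi * δ) ^ 4)) ^ 2
        ≤ 2 * C ^ 2 * T ^ 2 * ((n : ℝ)⁻¹) ^ 2 + C1 * δ ^ 8 := by
          rw [hC1, div_eq_mul_inv]
          linarith [mul_nonneg (sq_nonneg C)
            (sq_nonneg (T * (n : ℝ)⁻¹ - D * (2 * Real.pi * δ) ^ 4))]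
      _ ≤ _ := by gcongr
  have hbias2 := (pow_le_pow_left₀ (abs_nonneg _) hb' 2).trans hsq
  rw [sq_abs] at hbias2
  have e : R * (C ^ 2 / (δ * n)) = R * C ^ 2 * (δ⁻¹ * (n : ℝ)⁻¹) := by
    rw [div_eq_mul_inv, mul_inv]; ring
  rw [e] at hvar
  linarith [mul_nonneg hC10 hrate, mul_nonneg hC20 hδ8, hm.trans (add_le_add hbias2 hvar)]

end MSE

/-! ### Rates -/

/-- If `η` is at least `n ^ (-1/9)`, the term `η ^ 8` is large enough; otherwise `η⁻¹ n⁻¹` is. -/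
lemma rpow_le_mseRate {n : ℕ} {η : ℝ} (hn : 0 < n) (hη : 0 < η) :
    (n : ℝ) ^ (-(8 / 9) : ℝ) ≤ mseRate n η := by
  have hn' : (0 : ℝ) < n := by exact_mod_cast hn
  have h1 : 0 ≤ η ^ 8 := by positivity
  have h2 : 0 ≤ η⁻¹ * (n : ℝ)⁻¹ := by positivity
  unfold mseRate
  rcases le_total ((n : ℝ) ^ (-(1 / 9) : ℝ)) η with h | h
  · have : (n : ℝ) ^ (-(8 / 9) : ℝ) = ((n : ℝ) ^ (-(1 / 9) : ℝ)) ^ 8 := by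
      rw [← Real.rpow_natCast, ← Real.rpow_mul hn'.le]
      norm_num
    rw [this]
    have : ((n : ℝ) ^ (-(1 / 9) : ℝ)) ^ 8 ≤ η ^ 8 := by gcongr
    linarith
  · have e : (n : ℝ) ^ (-(8 / 9) : ℝ) = ((n : ℝ) ^ (-(1 / 9) : ℝ))⁻¹ * (n : ℝ)⁻¹ := by
      rw [← Real.rpow_neg hn'.le, ← Real.rpow_neg_one (n : ℝ), ← Real.rpow_add hn']
      norm_num
    rw [e]
    have : ((n : ℝ) ^ (-(1 / 9) : ℝ))⁻¹ ≤ η⁻¹ := inv_anti₀ hη h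
    have := mul_le_mul_of_nonneg_right this (inv_nonneg.2 hn'.le)
    linarith

lemma eventually_bounds_of_isEquivalent {C : ℝ} (hC : 0 < C) {δ : ℕ → ℝ}
    (hδ : δ ~[atTop] fun n : ℕ => C * (n : ℝ) ^ (-(1 / 9) : ℝ)) :
    ∀ᶠ n : ℕ in atTop, C / 2 * (n : ℝ) ^ (-(1 / 9) : ℝ) ≤ δ n ∧
      δ n ≤ 2 * C * (n : ℝ) ^ (-(1 / 9) : ℝ) := by
  have h := hδ.isLittleO.bound (c := 1 / 2) (by norm_num)
  filter_upwards [h] with n hn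
  have hr : 0 ≤ (n : ℝ) ^ (-(1 / 9) : ℝ) := by positivity
  have hv : 0 ≤ C * (n : ℝ) ^ (-(1 / 9) : ℝ) := by positivity
  rw [Pi.sub_apply, Real.norm_eq_abs, Real.norm_eq_abs, abs_of_nonneg hv, abs_le] at hn
  constructor <;> linarith [hn.1, hn.2]

/-- The bandwidth tends to zero while `δ n` grows like `n ^ (8/9)`, so the uniform bound eventually
applies. -/
lemma eventually_admissible {C : ℝ} (hC : 0 < C) {δ : ℕ → ℝ}
    (hδ : δ ~[atTop] fun n : ℕ => C * (n : ℝ) ^ (-(1 / 9) : ℝ)) (L : ℝ) :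
    ∀ᶠ n : ℕ in atTop, 0 < n ∧ 0 < δ n ∧ δ n < 1 / 2 ∧ L ≤ δ n * n := by
  have h1 : Tendsto (fun n : ℕ => 2 * C * (n : ℝ) ^ (-(1 / 9) : ℝ)) atTop (𝓝 0) := by
    have := ((tendsto_rpow_neg_atTop (y := 1 / 9) (by norm_num)).comp
      tendsto_natCast_atTop_atTop).const_mul (2 * C)
    rwa [mul_zero] at this
  have h2 : Tendsto (fun n : ℕ => C / 2 * (n : ℝ) ^ (8 / 9 : ℝ)) atTop atTop :=
    ((tendsto_rpow_atTop (by norm_num : (0 : ℝ) < 8 / 9)).comp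
      tendsto_natCast_atTop_atTop).const_mul_atTop (by positivity)
  filter_upwards [eventually_bounds_of_isEquivalent hC hδ,
    h1.eventually (gt_mem_nhds (by norm_num : (0 : ℝ) < 1 / 2)), h2.eventually_ge_atTop L,
    eventually_gt_atTop 0] with n hb hs hl hn
  have hn' : (0 : ℝ) < n := by exact_mod_cast hn
  refine ⟨hn, lt_of_lt_of_le (by positivity) hb.1, hb.2.trans_lt hs, hl.trans ?_⟩
  have e : (n : ℝ) ^ (8 / 9 : ℝ) = (n : ℝ) ^ (-(1 / 9) : ℝ) * n := by
    nth_rewrite 3 [← Real.rpow_one (n : ℝ)]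
    rw [← Real.rpow_add hn']
    norm_num
  rw [e, ← mul_assoc]
  exact mul_le_mul_of_nonneg_right hb.1 hn'.le

lemma exists_mseRate_le {C : ℝ} (hC : 0 < C) {δ : ℕ → ℝ}
    (hδ : δ ~[atTop] fun n : ℕ => C * (n : ℝ) ^ (-(1 / 9) : ℝ)) :
    ∃ D : ℝ, ∀ᶠ n : ℕ in atTop, mseRate n (δ n) ≤ D * (n : ℝ) ^ (-(8 / 9) : ℝ) := by
  refine ⟨(2 * C) ^ 8 + (C / 2)⁻¹, ?_⟩
  filter_upwards [eventually_bounds_of_isEquivalent hC hδ, eventually_admissible hC hδ 0]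
    with n hb ha
  obtain ⟨hn, hδ0, -, -⟩ := ha
  have hn' : (0 : ℝ) < n := by exact_mod_cast hn
  have hr : 0 < (n : ℝ) ^ (-(1 / 9) : ℝ) := by positivity
  have e8 : (n : ℝ) ^ (-(8 / 9) : ℝ) = ((n : ℝ) ^ (-(1 / 9) : ℝ)) ^ 8 := by
    rw [← Real.rpow_natCast, ← Real.rpow_mul hn'.le]
    norm_num
  have e1 : (n : ℝ) ^ (-(8 / 9) : ℝ) = ((n : ℝ) ^ (-(1 / 9) : ℝ))⁻¹ * (n : ℝ)⁻¹ := by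
    rw [← Real.rpow_neg hn'.le, ← Real.rpow_neg_one (n : ℝ), ← Real.rpow_add hn']
    norm_num
  have p1 : δ n ^ 8 ≤ (2 * C) ^ 8 * (n : ℝ) ^ (-(8 / 9) : ℝ) := by
    rw [e8, ← mul_pow]
    exact pow_le_pow_left₀ hδ0.le hb.2 8
  have p2 : (δ n)⁻¹ * (n : ℝ)⁻¹ ≤ (C / 2)⁻¹ * (n : ℝ) ^ (-(8 / 9) : ℝ) := by
    rw [e1, ← mul_assoc, ← mul_inv (C / 2)]
    exact mul_le_mul_of_nonneg_right (inv_anti₀ (by positivity) hb.1) (inv_nonneg.2 hn'.le)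
  unfold mseRate
  linarith

lemma isBigO_mseRate {C : ℝ} (hC : 0 < C) {δ : ℕ → ℝ}
    (hδ : δ ~[atTop] fun n : ℕ => C * (n : ℝ) ^ (-(1 / 9) : ℝ)) :
    (fun n => mseRate n (δ n)) =O[atTop] fun n : ℕ => (n : ℝ) ^ (-(8 / 9) : ℝ) := by
  obtain ⟨D, hD⟩ := exists_mseRate_le hC hδ
  refine IsBigO.of_bound D ?_
  filter_upwards [hD, eventually_admissible hC hδ 0] with n hn ha
  have hn' : (0 : ℝ) < n := by exact_mod_cast ha.1
  have h0 : 0 ≤ mseRate n (δ n) := le_trans (by positivity) (rpow_le_mseRate ha.1 ha.2.1)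
  rw [Real.norm_of_nonneg h0, Real.norm_of_nonneg (by positivity)]
  exact hn

lemma isBigO_rpow_mseRate {η : ℕ → ℝ} (hη : ∀ᶠ n in atTop, 0 < η n) :
    (fun n : ℕ => (n : ℝ) ^ (-(8 / 9) : ℝ)) =O[atTop] fun n => mseRate n (η n) := by
  refine IsBigO.of_bound 1 ?_
  filter_upwards [hη, eventually_gt_atTop 0] with n hn h0
  have h := rpow_le_mseRate h0 hn
  rw [Real.norm_of_nonneg (by positivity), one_mul]
  exact h.trans (le_abs_self _)

/-! ### From mean squares to boundedness in probability. -/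

section InProbability

variable {Ω : Type*} [MeasurableSpace Ω] {P : Measure Ω} [IsProbabilityMeasure P]

/-- Markov's inequality for a random matrix whose entries have bounded mean squares. -/
lemma measureReal_norm_gt_le {m : ℕ} (Y : Ω → Matrix (Fin m) (Fin m) ℂ)
    (hY : ∀ j k, Integrable (fun ω => ‖Y ω j k‖ ^ 2) P) {D b : ℝ} (hb : 0 < b)
    (hD : ∀ j k, ∫ ω, ‖Y ω j k‖ ^ 2 ∂P ≤ D) :
    P.real {ω | b < ‖Y ω‖} ≤ (m : ℝ) ^ 2 * (D / b ^ 2) := by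
  -- The matrix norm is the largest entry norm, so a large matrix has a large entry and a union over
  -- `m ^ 2` events suffices.
  have hsub : {ω | b < ‖Y ω‖} ⊆
      ⋃ x ∈ (Finset.univ : Finset (Fin m × Fin m)), {ω | b ^ 2 ≤ ‖Y ω x.1 x.2‖ ^ 2} := by
    intro ω hω
    by_contra hcon
    simp only [Set.mem_iUnion, Finset.mem_univ, exists_prop, true_and, not_exists] at hcon
    have hle : ‖Y ω‖ ≤ b := by
      rw [Matrix.norm_le_iff hb.le]
      intro j k
      have h := hcon (j, k)
      simp only [Set.mem_ofPred_eq, not_le] at h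
      exact (lt_of_pow_lt_pow_left₀ 2 hb.le h).le
    exact absurd hω (not_lt.2 hle)
  have hone : ∀ x : Fin m × Fin m, P.real {ω | b ^ 2 ≤ ‖Y ω x.1 x.2‖ ^ 2} ≤ D / b ^ 2 := by
    intro x
    have h := mul_meas_ge_le_integral_of_nonneg (μ := P)
      (Eventually.of_forall fun ω => sq_nonneg ‖Y ω x.1 x.2‖) (hY x.1 x.2) (b ^ 2)
    rw [le_div_iff₀ (by positivity), mul_comm]
    exact h.trans (hD x.1 x.2)
  calc P.real {ω | b < ‖Y ω‖}
      ≤ P.real (⋃ x ∈ (Finset.univ : Finset (Fin m × Fin m)),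
          {ω | b ^ 2 ≤ ‖Y ω x.1 x.2‖ ^ 2}) := measureReal_mono hsub (measure_ne_top _ _)
    _ ≤ ∑ x : Fin m × Fin m, P.real {ω | b ^ 2 ≤ ‖Y ω x.1 x.2‖ ^ 2} :=
        measureReal_biUnion_finset_le _ _
    _ ≤ ∑ _x : Fin m × Fin m, D / b ^ 2 := Finset.sum_le_sum fun x _ => hone x
    _ = _ := by
        rw [Finset.sum_const, Finset.card_univ, Fintype.card_prod, Fintype.card_fin, nsmul_eq_mul]
        push_cast
        ring

lemma isBigOInProb_of_mean_sq {m : ℕ} (Y : ℕ → Ω → Matrix (Fin m) (Fin m) ℂ)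
    (hY : ∀ n j k, Integrable (fun ω => ‖Y n ω j k‖ ^ 2) P) (a : ℕ → ℝ)
    (ha : ∀ᶠ n in atTop, 0 < a n)
    (hO : ∀ j k, (fun n => ∫ ω, ‖Y n ω j k‖ ^ 2 ∂P) =O[atTop] fun n => a n ^ 2) :
    IsBigOInProb P Y a := by
  choose c hc using fun j k => (hO j k).bound
  set D := ∑ j, ∑ k, |c j k| with hD
  have hD0 : 0 ≤ D := Finset.sum_nonneg fun j _ => Finset.sum_nonneg fun k _ => abs_nonneg _
  have hcD : ∀ j k, c j k ≤ D := by
    intro j k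
    calc c j k ≤ |c j k| := le_abs_self _
      _ ≤ ∑ k, |c j k| := Finset.single_le_sum (f := fun k => |c j k|)
          (fun _ _ => abs_nonneg _) (Finset.mem_univ k)
      _ ≤ D := Finset.single_le_sum (f := fun j => ∑ k, |c j k|)
          (fun _ _ => Finset.sum_nonneg fun _ _ => abs_nonneg _) (Finset.mem_univ j)
  intro ε hε
  -- Chosen so that `m ^ 2 * D / B ^ 2 ≤ ε`; adding one keeps `B` positive when `m ^ 2 * D = 0`.
  set B := Real.sqrt ((m : ℝ) ^ 2 * D / ε) + 1 with hB
  have hBpos : 0 < B := by positivity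
  have hB2 : (m : ℝ) ^ 2 * D / ε ≤ B ^ 2 := by
    have h1 := Real.sq_sqrt (show 0 ≤ (m : ℝ) ^ 2 * D / ε by positivity)
    have h2 := Real.sqrt_nonneg ((m : ℝ) ^ 2 * D / ε)
    rw [hB]
    nlinarith
  refine ⟨B, ?_⟩
  have hev : ∀ᶠ n in atTop, ∀ j k, ‖∫ ω, ‖Y n ω j k‖ ^ 2 ∂P‖ ≤ c j k * ‖a n ^ 2‖ :=
    eventually_all.2 fun j => eventually_all.2 fun k => hc j k
  filter_upwards [hev, ha] with n hn han
  have hint : ∀ j k, ∫ ω, ‖Y n ω j k‖ ^ 2 ∂P ≤ D * a n ^ 2 := by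
    intro j k
    refine (le_abs_self _).trans ((hn j k).trans ?_)
    rw [Real.norm_of_nonneg (sq_nonneg (a n))]
    exact mul_le_mul_of_nonneg_right (hcD j k) (sq_nonneg _)
  have h := measureReal_norm_gt_le (Y n) (hY n) (mul_pos hBpos han) hint
  rw [← ofReal_measureReal]
  refine ENNReal.ofReal_le_ofReal (h.trans ?_)
  have e : (m : ℝ) ^ 2 * (D * a n ^ 2 / (B * a n) ^ 2) = (m : ℝ) ^ 2 * D / B ^ 2 := by
    field_simp
  rw [e, div_le_iff₀ (by positivity)]
  rw [div_le_iff₀ hε] at hB2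
  linarith

end InProbability

end LocalQuad

/-! ### The main theorem. -/

theorem corollary4p1 {Ω : Type*} [MeasurableSpace Ω] (P : Measure Ω) [IsProbabilityMeasure P]
    {m : ℕ} (X : ℤ → Ω → (Fin m → ℝ)) (hX : ∀ t, Measurable (X t))
    (hstat : LocalQuad.StrictlyStationary P X) (hgauss : IsGaussianProcess X P)
    (hA : LocalQuad.AssumptionA P X 4)
    (K : ℝ → ℝ) (hK : LocalQuad.IsKernel K)
    (θ : ℝ) (hθ : θ = 0 ∨ θ = Real.pi ∨ θ = -Real.pi) :
    -- the mean squared error is finite, and `O(δ⁸) + O(δ⁻¹ n⁻¹)`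
    (∀ j k : Fin m,
      (∀ (n : ℕ) (δ : ℝ), Integrable (fun ω => ‖LocalQuad.estError P X K θ n δ ω j k‖ ^ 2) P) ∧
      ∃ C L : ℝ, ∀ (n : ℕ) (δ : ℝ), 0 < δ → δ < 1 / 2 → L ≤ δ * n →
        LocalQuad.mse P X K θ n δ j k ≤ C * δ ^ 8 + C * (δ⁻¹ * (n : ℝ)⁻¹)) ∧
    ∀ C : ℝ, 0 < C → ∀ δ : ℕ → ℝ,
      (δ ~[atTop] fun n : ℕ => C * (n : ℝ) ^ (-(1 / 9) : ℝ)) →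
      -- this choice minimizes the order of magnitude of the rate
      (∀ η : ℕ → ℝ, (∀ᶠ n in atTop, 0 < η n) →
        (fun n => LocalQuad.mseRate n (δ n)) =O[atTop] fun n => LocalQuad.mseRate n (η n)) ∧
      -- the minimal order is `n ^ (-8/9)`
      ((fun n => LocalQuad.mseRate n (δ n)) =Θ[atTop] fun n : ℕ => (n : ℝ) ^ (-(8 / 9) : ℝ)) ∧
      (∀ j k : Fin m, (fun n => LocalQuad.mse P X K θ n (δ n) j k)
        =O[atTop] fun n : ℕ => (n : ℝ) ^ (-(8 / 9) : ℝ)) ∧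
      -- the matrix estimator converges at rate `n ^ (-4/9)`
      LocalQuad.IsBigOInProb P (fun n ω => LocalQuad.estError P X K θ n (δ n) ω)
        (fun n : ℕ => (n : ℝ) ^ (-(4 / 9) : ℝ)) := by
  have hmse := fun j k => LocalQuad.exists_mse_le hX hstat hgauss hA hK hθ j k
  have hint := fun n δ j k => LocalQuad.integrable_norm_sq_estError (P := P) hgauss hθ K n δ j k
  refine ⟨fun j k => ⟨fun n δ => hint n δ j k, ?_⟩, fun C hC δ hδ => ?_⟩
  · obtain ⟨C, L, -, h⟩ := hmse j k
    exact ⟨C, L, h⟩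
  have hO : ∀ j k : Fin m, (fun n => LocalQuad.mse P X K θ n (δ n) j k) =O[atTop]
      fun n : ℕ => (n : ℝ) ^ (-(8 / 9) : ℝ) := by
    intro j k
    obtain ⟨D, L, hD, h⟩ := hmse j k
    refine IsBigO.trans (IsBigO.of_bound D ?_) (LocalQuad.isBigO_mseRate hC hδ)
    filter_upwards [LocalQuad.eventually_admissible hC hδ L] with n hn
    have h1 := h n (δ n) hn.2.1 hn.2.2.1 hn.2.2.2
    rw [← mul_add] at h1
    have h0 : 0 ≤ LocalQuad.mse P X K θ n (δ n) j k := integral_nonneg fun ω => sq_nonneg _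
    rw [Real.norm_of_nonneg h0]
    exact h1.trans (mul_le_mul_of_nonneg_left (le_abs_self _) hD)
  have hpos : ∀ᶠ n in atTop, 0 < δ n :=
    (LocalQuad.eventually_admissible hC hδ 0).mono fun n hn => hn.2.1
  refine ⟨fun η hη => (LocalQuad.isBigO_mseRate hC hδ).trans (LocalQuad.isBigO_rpow_mseRate hη),
    ⟨LocalQuad.isBigO_mseRate hC hδ, LocalQuad.isBigO_rpow_mseRate hpos⟩, hO,
    LocalQuad.isBigOInProb_of_mean_sq _ (fun n j k => hint n (δ n) j k) _ ?_ fun j k => ?_⟩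
  · filter_upwards [eventually_gt_atTop 0] with n hn
    have hn' : (0 : ℝ) < n := by exact_mod_cast hn
    positivity
  · refine (hO j k).congr_right fun n => ?_
    rw [← Real.rpow_natCast, ← Real.rpow_mul (Nat.cast_nonneg n)]
    norm_num
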